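/- **Setting.** Let $\mathscr O$ be a measurable observation space with a $\sigma$-finite reference measure $\nu$ (counting measure in the discrete case), $\mathscr A$ a finite action set, $H\ge 1$ the episode length, and $R_h:\mathscr O\to[0,1]$ ($h\in[H]$) known measurable rewards. A system $\mathbb P$ is given by conditional densities $\mathbb P_h(o_h\mid o_{1:h-1},a_{1:h-1})$ with respect to $\nu$; write $\overline{\mathbb P}(\tau)=\prod_{h}\mathbb P_h(o_h\mid o_{1:h-1},a_{1:h-1})$ for $\tau=(o_{1:H},a_{1:H})$. A policy $\pi$ gives conditional action probabilities $\pi_h(a_h\mid o_{1:h},a_{1:h-1})$; write $\pi(\tau)$ for their product and $\mathbb P^\pi(\tau)=\overline{\mathbb P}(\tau)\pi(\tau)$. Let $V^\pi_{\mathbb P}$ be the expected total reward. Let $\{\mathbb P_\theta\}_{\theta\in\Theta}$ be a model class with true model $\theta^\star\in\Theta$, write $V_\theta^\pi=V_{\mathbb P_\theta}^\pi$ and $V^\star=\max_\pi V^\pi_{\theta^\star}$, let $\pi_\theta$ be an optimal policy of $\mathbb P_\theta$ for each $\theta$, and let $d_{\rm TV}(\mathbb P^\pi,\mathbb Q^\pi)=\frac12\int|\mathbb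 P^\pi-\mathbb Q^\pi|$. Let $\Pi_{\rm exp}$ assign to every policy $\pi$ a finite collection $\Pi_{\rm exp}(\pi)$ of exploration policies, of size at most $|\Pi_{\rm exp}|$, where $|\Pi_{\rm exp}|\ge1$ is a fixed integer. For $\epsilon>0$ let $\mathcal N_\Theta(\epsilon)$ be the least number of brackets $[l,u]$ ($l,u$ measurable, $\sup_\pi\int|l-u|\,\pi<\epsilon$) such that every $\overline{\mathbb P}_\theta$ lies in one of them. **SAIL condition** with parameters $d,\kappa,B$: there are $m,n$ and maps $f_{h,i},g_{h,j}:\Theta\to\mathbb R^d$ ($0\le h\le H$, $i\in[m]$, $j\in[n]$) such that for all $\theta,\theta'\in\Theta$ and all $h$: 1. $d_{\rm TV}(\mathbb P^{\pi_\theta}_{\theta^\star},\mathbb P^{\pi_\theta}_{\theta})\le\sum_{h,i,j}|\langle f_{h,i}(\theta),g_{h,j}(\theta)\rangle|$; 2. $\sum_{h,i,j}|\langle f_{h,i}(\theta),g_{h,j}(\theta')\rangle|\le\kappa\sum_{\tilde\pi\in\Pi_{\rm exp}(\pi_\theta)}d_{\rm TV}(\mathbb P^{\tilde\pi}_{\theta^\star},\mathbb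 P^{\tilde\pi}_{\theta'})$; 3. $\big(\sum_i\|f_{h,i}(\theta)\|_1\big)\big(\sum_j\|g_{h,j}(\theta')\|_\infty\big)\le B$. **OMLE** with parameter $\beta$, for $K$ episodes: $\mathcal B^1=\Theta$, $\mathcal D=\emptyset$. In episode $k=1,\dots,K$, choose $\theta^k\in\mathcal B^k$ and $\pi^k=\pi_{\theta^k}$ such that $(\theta^k,\pi^k)$ maximizes $V^\pi_\theta$ over $\theta\in\mathcal B^k$ and all policies $\pi$ (the maximum is assumed to be attained, and the executed policies to depend measurably on the past); execute each $\pi\in\Pi_{\rm exp}(\pi^k)$ once in $\mathbb P_{\theta^\star}$, add the resulting pairs $(\pi,\tau)$ to $\mathcal D$, and set $$\mathcal B^{k+1}=\Big\{\theta\in\Theta:\ \sum_{(\pi,\tau)\in\mathcal D}\log\mathbb P^\pi_\theta(\tau)\ \ge\ \sup_{\theta'\in\Theta}\sum_{(\pi,\tau)\in\mathcal D}\log\mathbb P^\pi_{\theta'}(\tau)-\beta\Big\}\cap\mathcal B^k .$$ The output $\pi^{\rm out}$ draws one of $\pi^1,\dots,\pi^K$ uniformly at random at the start of an episode and follows it.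 **Theorem.** There are absolute constants $c,C>0$ and $p\in\mathbb N$ such that the following holds whenever the model class satisfies the SAIL condition with parameters $d,\kappa,B$. Put $$d_\Theta=\kappa^2d^2|\Pi_{\rm exp}|\cdot CH^p,\qquad \xi(k,\Delta)=C(1+\log k)^2\Big(\sqrt{d_\Theta\,\Delta\,|\Pi_{\rm exp}|\,k}+dB\cdot CH^p\Big).$$ (a) (Generalized eluder-type condition.) For all $K\in\mathbb N$, $\Delta\ge0$ and $\theta^1,\dots,\theta^K\in\Theta$, with $\pi^t=\pi_{\theta^t}$: if $\sum_{t=1}^{k-1}\sum_{\pi\in\Pi_{\rm exp}(\pi^t)}d_{\rm TV}^2(\mathbb P^\pi_{\theta^k},\mathbb P^\pi_{\theta^\star})\le\Delta$ for all $k\in[K]$, then $\sum_{t=1}^kd_{\rm TV}(\mathbb P^{\pi^t}_{\theta^t},\mathbb P^{\pi^t}_{\theta^\star})\le\xi(k,\Delta)$ for all $k\in[K]$. (b) For all integers $K\ge1$ and $\delta\in(0,1]$, if $T=K|\Pi_{\rm exp}|$, $\mathcal N_\Theta(1/T)<\infty$ and OMLE is run with $\beta=c\log\big(T\,\mathcal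 N_\Theta(1/T)/\delta\big)$, then with probability at least $1-\delta$, $$\sum_{t=1}^k\big(V^\star-V^{\pi^t}_{\theta^\star}\big)\le\xi(k,\beta)\ \text{ for all }k\in[K],\qquad\text{and}\qquad V^\star-V^{\pi^{\rm out}}_{\theta^\star}\le\xi(K,\beta)/K .$$ In particular the bounds do not depend on $m$ and $n$ (nor on the size of $\mathscr O$). -/

import Mathlib

open MeasureTheory

universe u v w x

noncomputable section

namespace SeqDM

/-- Trajectories of length `H`: observation-action pairs in the order in which they occur. -/
abbrev Traj (O A : Type*) (H : ℕ) := Fin H → O × A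

/-- The first `h` observation-action pairs of a trajectory. -/
def past {O A : Type*} {H : ℕ} (τ : Traj O A H) (h : Fin H) : Fin (h : ℕ) → O × A :=
  fun i => τ ⟨i, i.2.trans h.2⟩

/-- System dynamics on the observation space `O`, given by conditional densities with respect to
the reference measure `ν` (counting measure for discrete observations): `dens h x o` is the
density of the next observation `o` given the earlier observation-action pairs `x`. -/
structure Dynamics (O A : Type*) [MeasurableSpace O] [MeasurableSpace A] (H : ℕ)
    (ν : Measure O) where
  dens : (h : Fin H) → (Fin (h : ℕ) → O × A) → O → ℝ
  nonneg : ∀ h x o, 0 ≤ dens h x o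
  measurable : ∀ h : Fin H, Measurable fun z : (Fin (h : ℕ) → O × A) × O => dens h z.1 z.2
  normalized : ∀ h x, ∫⁻ o, ENNReal.ofReal (dens h x o) ∂ν = 1

/-- History-dependent randomized policies: `prob h x o a` is the probability of the action `a`
after the earlier observation-action pairs `x` and the current observation `o`. -/
structure Policy (O A : Type*) [MeasurableSpace O] [MeasurableSpace A] [Fintype A] (H : ℕ) where
  prob : (h : Fin H) → (Fin (h : ℕ) → O × A) → O → A → ℝ
  nonneg : ∀ h x o a, 0 ≤ prob h x o a
  measurable : ∀ (h : Fin H) a, Measurable fun z : (Fin (h : ℕ) → O × A) × O => prob h z.1 z.2 a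
  sum_eq_one : ∀ h x o, ∑ a, prob h x o a = 1

variable {O A : Type*} [MeasurableSpace O] [MeasurableSpace A] [Fintype A] {H : ℕ}
  {ν : Measure O}

/-- The density of the observations of `τ` conditioned on its actions. -/
def Dynamics.obsDensity (P : Dynamics O A H ν) (τ : Traj O A H) : ℝ :=
  ∏ h : Fin H, P.dens h (past τ h) (τ h).1

/-- The probability that the policy takes the actions of `τ` along the observations of `τ`. -/
def Policy.weight (π : Policy O A H) (τ : Traj O A H) : ℝ :=
  ∏ h : Fin H, π.prob h (past τ h) (τ h).1 (τ h).2

/-- The reference measure on trajectories, `ν` on observations and counting on actions. -/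
def refMeasure (A : Type*) [MeasurableSpace A] (H : ℕ) {O : Type*} [MeasurableSpace O]
    (ν : Measure O) : Measure (Traj O A H) :=
  Measure.pi fun _ : Fin H => ν.prod (Measure.count : Measure A)

/-- The density of the trajectory when the policy `π` is run in the system `P`. -/
def trajDensity (P : Dynamics O A H ν) (π : Policy O A H) (τ : Traj O A H) : ℝ :=
  P.obsDensity τ * π.weight τ

/-- The law of the trajectory when the policy `π` is run in the system `P`. -/
def trajLaw (P : Dynamics O A H ν) (π : Policy O A H) : Measure (Traj O A H) :=
  (refMeasure A H ν).withDensity fun τ => ENNReal.ofReal (trajDensity P π τ)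

/-- Total variation distance between the trajectory laws of `P` and `Q` under `π`. -/
def tvDist (P Q : Dynamics O A H ν) (π : Policy O A H) : ℝ :=
  (1 / 2) * ∫ τ, |trajDensity P π τ - trajDensity Q π τ| ∂(refMeasure A H ν)

/-- The expected total reward when the trajectory has law `μ`. -/
def rewardOf (R : Fin H → O → ℝ) (μ : Measure (Traj O A H)) : ℝ :=
  ∫ τ, ∑ h : Fin H, R h (τ h).1 ∂μ

/-- The value of the policy `π` in the system `P`. -/
def value (R : Fin H → O → ℝ) (P : Dynamics O A H ν) (π : Policy O A H) : ℝ :=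
  rewardOf R (trajLaw P π)

/-- The optimal value in the system `P`. -/
def optValue (R : Fin H → O → ℝ) (P : Dynamics O A H ν) : ℝ :=
  ⨆ π : Policy O A H, value R P π

/-- The policy `π` attains the maximal value in the system `P`. -/
def IsOptimal (R : Fin H → O → ℝ) (P : Dynamics O A H ν) (π : Policy O A H) : Prop :=
  ∀ π' : Policy O A H, value R P π' ≤ value R P π

/-- Policy-weighted `ℓ¹` distance, the maximum over all policies. -/
def policyDist (ν : Measure O) (l u : Traj O A H → ℝ) : ENNReal :=
  ⨆ π : Policy O A H,
    ∫⁻ τ, ENNReal.ofReal (|l τ - u τ| * π.weight τ) ∂(refMeasure A H ν)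

/-- The least number of `ε`-brackets that cover the model class, in the policy-weighted `ℓ¹`
distance (`⊤` if no finite number suffices). -/
def bracketingNumber {Θ : Type*} (P : Θ → Dynamics O A H ν) (ε : ℝ) : ℕ∞ :=
  sInf {N : ℕ∞ | ∃ (n : ℕ) (l u : Fin n → Traj O A H → ℝ), N = n ∧
    (∀ i, Measurable (l i) ∧ Measurable (u i) ∧
      policyDist ν (l i) (u i) < ENNReal.ofReal ε) ∧
    ∀ θ, ∃ i, ∀ τ, l i τ ≤ (P θ).obsDensity τ ∧ (P θ).obsDensity τ ≤ u i τ}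

/-- The SAIL condition with parameters `d`, `κ`, `B` for the model class `P` with true model
`θstar`, greedy policies `greedy θ` and exploration policies `expl π`. The norm of a vector
`Fin d → ℝ` is the sup norm. -/
def SAIL {Θ : Type*} (P : Θ → Dynamics O A H ν) (θstar : Θ) (greedy : Θ → Policy O A H)
    (expl : Policy O A H → List (Policy O A H)) (d : ℕ) (κ B : ℝ) : Prop :=
  ∃ (m n : ℕ) (f : Fin (H + 1) → Fin m → Θ → Fin d → ℝ)
    (g : Fin (H + 1) → Fin n → Θ → Fin d → ℝ),
    (∀ θ, tvDist (P θstar) (P θ) (greedy θ) ≤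
      ∑ h, ∑ i, ∑ j, |∑ l, f h i θ l * g h j θ l|) ∧
    (∀ θ θ', ∑ h, ∑ i, ∑ j, |∑ l, f h i θ l * g h j θ' l| ≤
      κ * ((expl (greedy θ)).map fun π => tvDist (P θstar) (P θ') π).sum) ∧
    (∀ h θ θ', (∑ i, ∑ l, |f h i θ l|) * (∑ j, ‖g h j θ'‖) ≤ B)

/-- The generalized eluder-type condition with parameter `dΘ` and function `ξ`, where `N` is the
size of the exploration sets. Steps are numbered from `0`. -/
def EluderCondition {Θ : Type*} (P : Θ → Dynamics O A H ν) (θstar : Θ)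
    (greedy : Θ → Policy O A H) (expl : Policy O A H → List (Policy O A H)) (N : ℕ)
    (dΘ : ℝ) (ξ : ℝ → ℕ → ℝ → ℕ → ℝ) : Prop :=
  ∀ (K : ℕ) (Δ : ℝ), 0 ≤ Δ → ∀ θ : ℕ → Θ,
    (∀ k < K, ∑ t ∈ Finset.range k,
      ((expl (greedy (θ t))).map fun π => tvDist (P (θ k)) (P θstar) π ^ 2).sum ≤ Δ) →
    ∀ k, 1 ≤ k → k ≤ K →
      ∑ t ∈ Finset.range k, tvDist (P (θ t)) (P θstar) (greedy (θ t)) ≤ ξ dΘ k Δ N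

/-- Log-likelihood, in `[-∞, ∞]`, of the trajectories that were collected in the first `k`
episodes, where `e i` is the list of policies executed in episode `i` and `τ i j` is the
trajectory collected with the `j`-th policy of that list. -/
def logLik (e : ℕ → List (Policy O A H)) (τ : ℕ → ℕ → Traj O A H) (k : ℕ)
    (P : Dynamics O A H ν) : EReal :=
  ∑ i ∈ Finset.range k, ∑ j : Fin (e i).length,
    ENNReal.log (ENNReal.ofReal (trajDensity P ((e i).get j) (τ i j)))

/-- The confidence set of optimistic maximum likelihood estimation after `k` episodes. -/
def confSet {Θ : Type*} (P : Θ → Dynamics O A H ν) (β : ℝ) (e : ℕ → List (Policy O A H))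
    (τ : ℕ → ℕ → Traj O A H) : ℕ → Set Θ
  | 0 => Set.univ
  | k + 1 => {θ | (⨆ θ' : Θ, logLik e τ (k + 1) (P θ')) - (β : EReal) ≤
      logLik e τ (k + 1) (P θ)} ∩ confSet P β e τ k

/-- `K` episodes of optimistic maximum likelihood estimation (OMLE) with parameter `β`, run in the
system `P θstar`. Episodes are numbered from `0`; `ℱ k` is the information available before
episode `k`; `θ k` is the model selected in episode `k`, and `greedy (θ k)` the policy; `τ k j` is
the trajectory collected with the `j`-th policy of `expl (greedy (θ k))`. -/
structure IsOMLERun {Θ : Type*} (R : Fin H → O → ℝ) (P : Θ → Dynamics O A H ν) (θstar : Θ)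
    (greedy : Θ → Policy O A H) (expl : Policy O A H → List (Policy O A H)) (K : ℕ) (β : ℝ)
    {Ω : Type*} [mΩ : MeasurableSpace Ω] (ℙ : Measure Ω) (ℱ : Filtration ℕ mΩ)
    (θ : ℕ → Ω → Θ) (τ : ℕ → ℕ → Ω → Traj O A H) : Prop where
  /-- The collected trajectories are known after the episode. -/
  data_adapted : ∀ k < K, ∀ j, Measurable[ℱ (k + 1)] (τ k j)
  /-- The number of executed policies is known before the episode. -/
  length_adapted : ∀ k < K, Measurable[ℱ k] fun ω => (expl (greedy (θ k ω))).length
  /-- The executed policies are known before the episode: their action probabilities depend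
  measurably on the past and on the trajectory. -/
  policy_adapted : ∀ k < K, ∀ j : ℕ,
    Measurable[MeasurableSpace.prod (ℱ k) (inferInstance : MeasurableSpace (Traj O A H))]
      fun z : Ω × Traj O A H =>
        ((expl (greedy (θ k z.1)))[j]?).elim (0 : ℝ) fun π => π.weight z.2
  /-- Given the past, the trajectories of an episode are independent, each of them distributed
  according to the true system under the policy that is executed. -/
  sampling : ∀ k < K, ∀ E : Set Ω, MeasurableSet[ℱ k] E →
    ∀ S : ℕ → Set (Traj O A H), (∀ j, MeasurableSet (S j)) →
      ℙ (E ∩ {ω | ∀ j < (expl (greedy (θ k ω))).length, τ k j ω ∈ S j}) =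
        ∫⁻ ω in E, ∏ j : Fin (expl (greedy (θ k ω))).length,
          trajLaw (P θstar) ((expl (greedy (θ k ω))).get j) (S j) ∂ℙ
  /-- Optimistic planning: model and policy jointly maximize the value over the confidence set. -/
  planning : ∀ᵐ ω ∂ℙ, ∀ k < K,
    (confSet P β (fun i => expl (greedy (θ i ω))) (fun i j => τ i j ω) k).Nonempty →
      θ k ω ∈ confSet P β (fun i => expl (greedy (θ i ω))) (fun i j => τ i j ω) k ∧
      ∀ θ' ∈ confSet P β (fun i => expl (greedy (θ i ω))) (fun i j => τ i j ω) k,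
        ∀ π : Policy O A H, value R (P θ') π ≤ value R (P (θ k ω)) (greedy (θ k ω))

/-- The regret of the policies `π 0, …, π (k - 1)` in the system `P`. -/
def regret (R : Fin H → O → ℝ) (P : Dynamics O A H ν) (π : ℕ → Policy O A H) (k : ℕ) : ℝ :=
  ∑ t ∈ Finset.range k, (optValue R P - value R P (π t))

/-- The trajectory law of the output policy, which draws one of `π 0, …, π (K - 1)` uniformly at
random and then follows it. -/
def outputLaw (P : Dynamics O A H ν) (π : ℕ → Policy O A H) (K : ℕ) : Measure (Traj O A H) :=
  (K : ENNReal)⁻¹ • ∑ t ∈ Finset.range K, trajLaw P (π t)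

/-- The parameter `κ² d² |Π_exp| poly(H)`, with `poly(H) = C H ^ p`. -/
def sailDim (C : ℝ) (p H d : ℕ) (κ : ℝ) (N : ℕ) : ℝ :=
  κ ^ 2 * (d : ℝ) ^ 2 * N * (C * (H : ℝ) ^ p)

/-- The function `ξ(D, k, Δ, N) = polylog(k) (√(D Δ N k) + d B poly(H))`, with
`polylog(k) = C (1 + log k) ^ 2` and `poly(H) = C H ^ p`. -/
def sailBound (C : ℝ) (p H d : ℕ) (B : ℝ) (D : ℝ) (k : ℕ) (Δ : ℝ) (N : ℕ) : ℝ :=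
  C * (1 + Real.log k) ^ 2 * (Real.sqrt (D * Δ * N * k) + d * B * (C * (H : ℝ) ^ p))

end SeqDM

end

/-!
Both parts rest on elementary arguments with explicit constants (`c = 5`, `C = 1200`, `p = 4`).

**Eluder-type condition.** For a fixed `h`, the interaction `∑ i, ∑ j, |⟨f i (θ s), g j (θ t)⟩|` is
controlled off the diagonal (`s < t`) by the exploration distances, through the second SAIL
inequality and Cauchy–Schwarz, and has to be summed over the diagonal. An averaging argument
(`exists_collapse`) replaces the two families by single vectors `y t`, `w t` with the same diagonal
and at most twice the off-diagonal mass, which removes the numbers of vectors from the bound. To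
count the steps with `⟨w t, y t⟩ ≥ ε`, the steps are coloured with about `γ / ε` colours so that
within a colour the past interactions sum to at most `ε` (`exists_coloring`). A colour class is then
an `ε`-independent sequence, and the determinant of `λ I + ∑ y yᵀ` shows that it has at most
`O(d log k)` members (`three_halves_pow_card_le`). The passage between `ℓ¹`, `ℓ²` and `ℓ^∞` norms
only enters through the choice of `λ`, where it is cancelled by the arithmetic-geometric mean
inequality, so that no extra power of `d` appears. Summing over dyadic `ε` gives
`sum_self_interaction_family_le`.

**Maximum likelihood.** For an upper bracket `v` the product over the data of the factors
`√(v / P_θ⋆)`, each divided by its conditional expectation, is a nonnegative supermartingale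
(`IsAdaptiveSample.lintegral_ratioProcess_le_one`); the executed policies cancel in the ratio. The
conditional expectation is a Hellinger affinity, which is at most `exp (ε - d_TV² / 6)` for every
model in the bracket (`affinity_le_exp`). By Markov's inequality and a union bound over brackets and
episodes, with probability at least `1 - δ` the likelihood of every model `θ` is at most the true
one times `(M K / δ)² exp (2 - ∑ d_TV² / 3)` (`likelihood_le_of_ratioProcess_lt`). This one event
gives both that the true model stays in the confidence sets and that the members of these sets
satisfy `∑ d_TV² ≤ 6 β` (`confSet_spec`). Optimism bounds the regret by total variation distances
along the played policies (`regret_le_of_optimism`), and the eluder-type bound applies with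
`Δ = 6 β`.

The bound `β ≥ 2 log (M K / δ) + 2` requires `K ≥ 2`; it is only used for episodes after the first,
since the first one is played without data.
-/

noncomputable section

namespace SeqDM

set_option linter.unusedSectionVars false

/-! ### Determinant potential and pigeonhole for sequences of vectors -/

section

open Matrix Finset

theorem det_le_trace_div_card_pow {d : ℕ} (hd : 0 < d) {V : Matrix (Fin d) (Fin d) ℝ}
    (hV : V.PosSemidef) : V.det ≤ (V.trace / d) ^ d := by
  have hd' : (0 : ℝ) < d := by exact_mod_cast hd
  have hdet : V.det = ∏ i, hV.isHermitian.eigenvalues i := by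
    simpa using hV.isHermitian.det_eq_prod_eigenvalues
  have htr : V.trace = ∑ i, hV.isHermitian.eigenvalues i := by
    simpa using hV.isHermitian.trace_eq_sum_eigenvalues
  have hnn : ∀ i, 0 ≤ hV.isHermitian.eigenvalues i := hV.eigenvalues_nonneg
  have key := Real.geom_mean_le_arith_mean univ (fun _ : Fin d => (1 : ℝ))
    hV.isHermitian.eigenvalues (fun _ _ => zero_le_one) (by simpa using hd)
    (fun i _ => hnn i)
  simp only [Real.rpow_one, sum_const, card_univ, Fintype.card_fin, nsmul_eq_mul, mul_one,
    one_mul] at key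
  rw [← hdet, ← htr] at key
  have h0 : 0 ≤ V.det := by rw [hdet]; exact prod_nonneg fun i _ => hnn i
  calc V.det = (V.det ^ (d : ℝ)⁻¹) ^ d := (Real.rpow_inv_natCast_pow h0 hd.ne').symm
    _ ≤ _ := pow_le_pow_left₀ (Real.rpow_nonneg h0 _) key d

/-- A rank-one update along a direction in which the ellipsoid of `V` is wide, as witnessed by
`w`, multiplies the determinant by at least `3 / 2`. -/
theorem det_add_vecMulVec_ge {d : ℕ} {V : Matrix (Fin d) (Fin d) ℝ} (hV : V.PosDef)
    {w y : Fin d → ℝ} {ε : ℝ} (hε : 0 < ε) (hw : w ⬝ᵥ (V *ᵥ w) ≤ 2 * ε ^ 2)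
    (hy : ε ≤ w ⬝ᵥ y) : 3 / 2 * V.det ≤ (V + vecMulVec y y).det := by
  have hu : IsUnit V.det := (Matrix.isUnit_iff_isUnit_det V).1 hV.isUnit
  have hsymm : Vᵀ = V := by simpa using hV.isHermitian.eq
  have hdet : (V + vecMulVec y y).det = V.det * (1 + y ⬝ᵥ (V⁻¹ *ᵥ y)) := by
    rw [vecMulVec_eq Unit, det_add_replicateCol_mul_replicateRow hu, det_unique (n := Unit)]
    congr 1
    rw [Matrix.add_apply, one_apply_eq, Matrix.mul_assoc]
    simp [Matrix.mul_apply, dotProduct, mulVec]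
  have hz : V *ᵥ (V⁻¹ *ᵥ y) = y := by
    rw [mulVec_mulVec, Matrix.mul_nonsing_inv _ hu, one_mulVec]
  set z := V⁻¹ *ᵥ y with hzdef
  have hzw : z ⬝ᵥ (V *ᵥ w) = w ⬝ᵥ y := by
    rw [dotProduct_mulVec, ← mulVec_transpose, hsymm, hz, dotProduct_comm]
  -- Nonnegativity of the form at `w - 2 ε z`, with `z = V⁻¹ y`.
  have hpos := hV.posSemidef.dotProduct_mulVec_nonneg (w - (2 * ε) • z)
  simp only [star_trivial, mulVec_sub, mulVec_smul, hz, sub_dotProduct, dotProduct_sub,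
    smul_dotProduct, dotProduct_smul, smul_eq_mul, hzw] at hpos
  rw [dotProduct_comm z y] at hpos
  have hc : 1 / 2 ≤ y ⬝ᵥ z := by
    by_contra hlt
    push Not at hlt
    nlinarith [mul_pos hε hε]
  rw [hdet]
  nlinarith [hV.det_pos]

/-- A sequence of `ε`-independent vectors is short: if each `w t` nearly annihilates the earlier
vectors `y s` but not `y t`, then the determinant of `λ I + ∑ y s (y s)ᵀ` grows geometrically,
while it is at most polynomial in the number of vectors. -/
theorem three_halves_pow_card_le {d : ℕ} (S : Finset ℕ) (w y : ℕ → Fin d → ℝ) {ε Rw Rx : ℝ}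
    (hε : 0 < ε) (hRx : 0 ≤ Rx) (hw : ∀ t ∈ S, ∀ l, |w t l| ≤ Rw)
    (hy : ∀ t ∈ S, ∑ l, |y t l| ≤ Rx) (hself : ∀ t ∈ S, ε ≤ w t ⬝ᵥ y t)
    (hpast : ∀ t ∈ S, ∑ s ∈ S with s < t, |w t ⬝ᵥ y s| ≤ ε) :
    (3 / 2 : ℝ) ^ #S ≤ (1 + #S * (Rx * Rw / ε) ^ 2) ^ d := by
  rcases S.eq_empty_or_nonempty with rfl | ⟨t₀, ht₀⟩
  · simp
  have hdot : ε ≤ Rw * Rx := by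
    refine (hself t₀ ht₀).trans ?_
    calc w t₀ ⬝ᵥ y t₀ ≤ ∑ l, Rw * |y t₀ l| := by
          refine sum_le_sum fun l _ => (le_abs_self _).trans ?_
          rw [abs_mul]
          exact mul_le_mul_of_nonneg_right (hw t₀ ht₀ l) (abs_nonneg _)
      _ ≤ Rw * Rx := by
          rw [← mul_sum]
          rcases Nat.eq_zero_or_pos d with rfl | hd
          · have := (hself t₀ ht₀)
            simp [dotProduct] at this
            linarith
          · exact mul_le_mul_of_nonneg_left (hy t₀ ht₀)
              ((abs_nonneg _).trans (hw t₀ ht₀ ⟨0, hd⟩))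
  have hRw : 0 < Rw := by
    by_contra h
    push Not at h
    nlinarith
  have hd : 0 < d := by
    rcases Nat.eq_zero_or_pos d with rfl | hd
    · have := (hself t₀ ht₀)
      simp [dotProduct] at this
      linarith
    · exact hd
  have hd' : (0 : ℝ) < d := by exact_mod_cast hd
  -- With this weight the regularization contributes at most `ε ^ 2` to the form at each `w t`.
  set lam : ℝ := ε ^ 2 / (d * Rw ^ 2) with hlam
  have hlam0 : 0 < lam := by positivity
  let V : Finset ℕ → Matrix (Fin d) (Fin d) ℝ :=
    fun S => lam • (1 : Matrix (Fin d) (Fin d) ℝ) + ∑ s ∈ S, vecMulVec (y s) (y s)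
  have hV : ∀ S, (V S).PosDef := fun S =>
    (PosDef.one.smul hlam0).add_posSemidef
      (posSemidef_sum S fun s _ => by simpa using posSemidef_vecMulVec_self_star (y s))
  have hquad : ∀ (S : Finset ℕ) (v : Fin d → ℝ),
      v ⬝ᵥ (V S *ᵥ v) = lam * (v ⬝ᵥ v) + ∑ s ∈ S, (v ⬝ᵥ y s) ^ 2 := by
    intro S v
    simp only [V, add_mulVec, smul_mulVec, one_mulVec, dotProduct_add, dotProduct_smul,
      smul_eq_mul, sum_mulVec, dotProduct_sum, vecMulVec_mulVec]
    congr 1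
    refine sum_congr rfl fun s _ => ?_
    simp [dotProduct_comm (y s) v, sq]
  -- The determinant grows by a factor `3 / 2` with every vector.
  have hgrow : ∀ S' : Finset ℕ, S' ⊆ S → lam ^ d * (3 / 2 : ℝ) ^ #S' ≤ (V S').det := by
    intro S'
    induction S' using Finset.induction_on_max with
    | empty => intro _; simp [V]
    | insert a s hlt ih =>
      intro hsub
      have ha : a ∈ S := hsub (mem_insert_self a s)
      have hs : s ⊆ S := (subset_insert a s).trans hsub
      have hna : a ∉ s := fun h => lt_irrefl a (hlt a h)
      have hins : V (insert a s) = V s + vecMulVec (y a) (y a) := by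
        simp only [V]
        rw [sum_insert hna]
        abel
      have hsum : ∑ x ∈ s, |w a ⬝ᵥ y x| ≤ ε := by
        refine le_trans (sum_le_sum_of_subset_of_nonneg ?_ fun _ _ _ => abs_nonneg _)
          (hpast a ha)
        intro x hx
        exact mem_filter.2 ⟨hs hx, hlt x hx⟩
      have hsq : ∑ x ∈ s, (w a ⬝ᵥ y x) ^ 2 ≤ ε ^ 2 := by
        calc ∑ x ∈ s, (w a ⬝ᵥ y x) ^ 2 = ∑ x ∈ s, |w a ⬝ᵥ y x| ^ 2 := by simp
          _ ≤ (∑ x ∈ s, |w a ⬝ᵥ y x|) ^ 2 := sum_sq_le_sq_sum_of_nonneg fun _ _ => abs_nonneg _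
          _ ≤ ε ^ 2 := pow_le_pow_left₀ (sum_nonneg fun _ _ => abs_nonneg _) hsum 2
      have hww : w a ⬝ᵥ w a ≤ d * Rw ^ 2 := by
        calc w a ⬝ᵥ w a = ∑ l, |w a l| ^ 2 := by simp [dotProduct, sq]
          _ ≤ ∑ _l : Fin d, Rw ^ 2 :=
            sum_le_sum fun l _ => pow_le_pow_left₀ (abs_nonneg _) (hw a ha l) 2
          _ = d * Rw ^ 2 := by simp
      have hq : w a ⬝ᵥ (V s *ᵥ w a) ≤ 2 * ε ^ 2 := by
        rw [hquad]
        have : lam * (w a ⬝ᵥ w a) ≤ ε ^ 2 := by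
          calc lam * (w a ⬝ᵥ w a) ≤ lam * (d * Rw ^ 2) := by gcongr
            _ = ε ^ 2 := by rw [hlam]; field_simp
        linarith
      have := det_add_vecMulVec_ge (hV s) hε hq (hself a ha)
      rw [hins, card_insert_of_notMem hna, pow_succ]
      nlinarith [ih hs]
  have htr : (V S).trace ≤ d * lam + #S * Rx ^ 2 := by
    have h1 : (V S).trace = d * lam + ∑ s ∈ S, y s ⬝ᵥ y s := by
      simp [V, trace_sum, trace_vecMulVec, mul_comm]
    rw [h1]
    have h2 : ∑ s ∈ S, y s ⬝ᵥ y s ≤ ∑ _s ∈ S, Rx ^ 2 := by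
      refine sum_le_sum fun s hs => ?_
      calc y s ⬝ᵥ y s = ∑ l, |y s l| ^ 2 := by simp [dotProduct, sq]
        _ ≤ (∑ l, |y s l|) ^ 2 := sum_sq_le_sq_sum_of_nonneg fun _ _ => abs_nonneg _
        _ ≤ Rx ^ 2 := pow_le_pow_left₀ (sum_nonneg fun _ _ => abs_nonneg _) (hy s hs) 2
    simp only [sum_const, nsmul_eq_mul] at h2
    linarith
  have hup : (V S).det ≤ lam ^ d * (1 + #S * (Rx * Rw / ε) ^ 2) ^ d := by
    refine (det_le_trace_div_card_pow hd (hV S).posSemidef).trans ?_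
    rw [← mul_pow]
    refine pow_le_pow_left₀ (div_nonneg (hV S).posSemidef.trace_nonneg hd'.le) ?_ d
    rw [div_le_iff₀ hd']
    refine htr.trans (le_of_eq ?_)
    rw [hlam]
    field_simp
  have hl : 0 < lam ^ d := pow_pos hlam0 d
  exact le_of_mul_le_mul_left ((hgrow S subset_rfl).trans hup) hl

/-- Greedy colouring with `q` colours: every index sees at most a `q`-th of its interactions with
the past among the earlier indices of its own colour. -/
theorem exists_coloring (G : ℕ → ℕ → ℝ) {q : ℕ} (hq : 0 < q) (k : ℕ) :
    ∃ col : ℕ → Fin q, ∀ t < k,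
      q * ∑ s ∈ range t with col s = col t, G t s ≤ ∑ s ∈ range t, G t s := by
  induction k with
  | zero => exact ⟨fun _ => ⟨0, hq⟩, fun t ht => absurd ht (Nat.not_lt_zero t)⟩
  | succ k ih =>
    obtain ⟨col, hcol⟩ := ih
    have : Nonempty (Fin q) := ⟨⟨0, hq⟩⟩
    have hfib : ∑ c : Fin q, ∑ s ∈ range k with col s = c, G k s = ∑ s ∈ range k, G k s :=
      sum_fiberwise _ _ _
    obtain ⟨c, -, hc⟩ := exists_min_image univ
      (fun c : Fin q => ∑ s ∈ range k with col s = c, G k s) univ_nonempty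
    have hmin : q * ∑ s ∈ range k with col s = c, G k s ≤ ∑ s ∈ range k, G k s := by
      rw [← hfib]
      simpa using card_nsmul_le_sum univ
        (fun c : Fin q => ∑ s ∈ range k with col s = c, G k s) _ fun x _ => hc x (mem_univ x)
    refine ⟨Function.update col k c, fun t ht => ?_⟩
    have hold : ∀ s < k, Function.update col k c s = col s := fun s hs =>
      Function.update_of_ne hs.ne _ _
    rcases Nat.lt_succ_iff_lt_or_eq.1 ht with h | rfl
    · rw [hold t h, filter_congr fun s hs => by rw [hold s ((mem_range.1 hs).trans h)]]
      exact hcol t h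
    · rw [Function.update_self, filter_congr fun s hs => by rw [hold s (mem_range.1 hs)]]
      exact hmin

/-- Bound on the number of indices at which the interaction reaches `ε`, one term for each colour of
`exists_coloring`. -/
theorem card_large_le {d : ℕ} (k : ℕ) (w y : ℕ → Fin d → ℝ) {ε γ Rw Rx : ℝ}
    (hε : 0 < ε) (hγ : 0 ≤ γ) (hRx : 0 ≤ Rx) (hw : ∀ t < k, ∀ l, |w t l| ≤ Rw)
    (hy : ∀ t < k, ∑ l, |y t l| ≤ Rx)
    (hpast : ∀ t < k, ∑ s ∈ range t, |w t ⬝ᵥ y s| ≤ γ) :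
    (#{t ∈ range k | ε ≤ w t ⬝ᵥ y t} : ℝ) ≤
      (γ / ε + 1) * (d * Real.log (1 + k * (Rx * Rw / ε) ^ 2) / Real.log (3 / 2)) := by
  set Lm : ℝ := d * Real.log (1 + k * (Rx * Rw / ε) ^ 2) / Real.log (3 / 2) with hLm
  set q : ℕ := ⌊γ / ε⌋₊ + 1 with hq
  have hq0 : (0 : ℝ) < q := by rw [hq]; positivity
  have hqγ : γ ≤ q * ε := by
    have := (Nat.lt_floor_add_one (γ / ε)).le
    rw [div_le_iff₀ hε] at this
    rw [hq]
    push_cast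
    exact this
  have hqle : (q : ℝ) ≤ γ / ε + 1 := by
    rw [hq]
    push_cast
    linarith [Nat.floor_le (div_nonneg hγ hε.le)]
  have hlog : 0 < Real.log (3 / 2) := Real.log_pos (by norm_num)
  obtain ⟨col, hcol⟩ := exists_coloring (fun t s => |w t ⬝ᵥ y s|) (Nat.succ_pos ⌊γ / ε⌋₊) k
  have hclass : ∀ c : Fin q, (#{t ∈ {t ∈ range k | ε ≤ w t ⬝ᵥ y t} | col t = c} : ℝ) ≤ Lm := by
    intro c
    set S : Finset ℕ := {t ∈ {t ∈ range k | ε ≤ w t ⬝ᵥ y t} | col t = c} with hS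
    have hmem : ∀ t ∈ S, t < k ∧ ε ≤ w t ⬝ᵥ y t ∧ col t = c := by
      intro t ht
      simpa [hS, and_assoc] using ht
    have h := three_halves_pow_card_le S w y hε hRx (fun t ht => hw t (hmem t ht).1)
      (fun t ht => hy t (hmem t ht).1) (fun t ht => (hmem t ht).2.1) (fun t ht => by
        have h1 : ∑ s ∈ S with s < t, |w t ⬝ᵥ y s| ≤
            ∑ s ∈ range t with col s = col t, |w t ⬝ᵥ y s| := by
          refine sum_le_sum_of_subset_of_nonneg ?_ fun _ _ _ => abs_nonneg _
          intro s hs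
          obtain ⟨hs1, hs2⟩ := mem_filter.1 hs
          exact mem_filter.2
            ⟨mem_range.2 hs2, (hmem s hs1).2.2.trans (hmem t ht).2.2.symm⟩
        have h2 := (hcol t (hmem t ht).1).trans (hpast t (hmem t ht).1)
        exact h1.trans (le_of_mul_le_mul_left (h2.trans hqγ) hq0))
    have hcard : (#S : ℝ) ≤ k := by
      have : #S ≤ #(range k) := card_le_card fun t ht => mem_range.2 (hmem t ht).1
      rw [card_range] at this
      exact_mod_cast this
    have h' := Real.log_le_log (by positivity) h
    rw [Real.log_pow, Real.log_pow] at h'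
    rw [hLm, le_div_iff₀ hlog]
    refine h'.trans ?_
    gcongr
  have hsum : (#{t ∈ range k | ε ≤ w t ⬝ᵥ y t} : ℝ) =
      ∑ c : Fin q, (#{t ∈ {t ∈ range k | ε ≤ w t ⬝ᵥ y t} | col t = c} : ℝ) := by
    exact_mod_cast card_eq_sum_card_fiberwise fun t _ => mem_univ (col t)
  rw [hsum]
  have hLm0 : 0 ≤ Lm := le_trans (Nat.cast_nonneg _) (hclass ⟨0, Nat.succ_pos _⟩)
  calc _ ≤ ∑ _c : Fin q, Lm := sum_le_sum fun c _ => hclass c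
    _ = q * Lm := by simp
    _ ≤ _ := mul_le_mul_of_nonneg_right hqle hLm0

/-- Dyadic decomposition of a number in terms of the levels `B / 2 ^ (i + 1)` it reaches. -/
theorem le_sum_dyadic {m B : ℝ} (hB : 0 ≤ B) (hm : m ≤ B) (n : ℕ) :
    m ≤ B / 2 ^ n + ∑ i ∈ range n, B / 2 ^ i * if B / 2 ^ (i + 1) ≤ m then 1 else 0 := by
  induction n with
  | zero => simpa using hm
  | succ n ih =>
    have h0 : 0 ≤ B / 2 ^ (n + 1) := by positivity
    by_cases h : B / 2 ^ (n + 1) ≤ m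
    · rw [sum_range_succ, if_pos h]
      linarith
    · have : 0 ≤ ∑ i ∈ range (n + 1), B / 2 ^ i * if B / 2 ^ (i + 1) ≤ m then (1 : ℝ) else 0 :=
        sum_nonneg fun i _ => by positivity
      push Not at h
      linarith

/-- The sum of `k` numbers in terms of the numbers of them that reach the dyadic levels. -/
theorem sum_le_of_card_large_le {k : ℕ} (m : ℕ → ℝ) {B γ L : ℝ} (hB : 0 < B)
    (hm : ∀ t < k, m t ≤ B) (hL : 0 ≤ L)
    (hcard : ∀ i ≤ Nat.log 2 k,
      (#{t ∈ range k | B / 2 ^ (i + 1) ≤ m t} : ℝ) ≤ (γ / (B / 2 ^ (i + 1)) + 1) * L) :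
    ∑ t ∈ range k, m t ≤ B + L * ((Nat.log 2 k + 1) * (2 * γ) + 2 * B) := by
  set n := Nat.log 2 k + 1 with hn
  have hk2 : (k : ℝ) ≤ 2 ^ n := by
    exact_mod_cast (Nat.lt_pow_succ_log_self (by norm_num) k).le
  have h1 : ∀ i ∈ range n, ∑ t ∈ range k, B / 2 ^ i * (if B / 2 ^ (i + 1) ≤ m t then (1 : ℝ) else 0)
      ≤ L * (2 * γ) + L * B * (1 / 2) ^ i := by
    intro i hi
    rw [← mul_sum, sum_boole]
    have h2 := hcard i (Nat.lt_succ_iff.1 (mem_range.1 hi))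
    calc _ ≤ B / 2 ^ i * ((γ / (B / 2 ^ (i + 1)) + 1) * L) := by gcongr
      _ = _ := by
        rw [pow_succ, one_div, inv_pow]
        field_simp
  have hgeo : ∑ i ∈ range n, (1 / 2 : ℝ) ^ i ≤ 2 := by
    have := sum_geometric_two_le n
    simpa using this
  calc ∑ t ∈ range k, m t
      ≤ ∑ t ∈ range k, (B / 2 ^ n +
          ∑ i ∈ range n, B / 2 ^ i * if B / 2 ^ (i + 1) ≤ m t then 1 else 0) :=
        sum_le_sum fun t ht => le_sum_dyadic hB.le (hm t (mem_range.1 ht)) n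
    _ = k * (B / 2 ^ n) + ∑ i ∈ range n, ∑ t ∈ range k,
          B / 2 ^ i * (if B / 2 ^ (i + 1) ≤ m t then (1 : ℝ) else 0) := by
        rw [sum_add_distrib, sum_comm]
        simp
    _ ≤ B + ∑ i ∈ range n, (L * (2 * γ) + L * B * (1 / 2) ^ i) := by
        refine add_le_add ?_ (sum_le_sum h1)
        rw [← mul_div_assoc, div_le_iff₀ (by positivity)]
        nlinarith
    _ = B + (n * (L * (2 * γ)) + L * B * ∑ i ∈ range n, (1 / 2 : ℝ) ^ i) := by
        rw [sum_add_distrib, mul_sum, sum_const, card_range, nsmul_eq_mul]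
    _ ≤ B + (n * (L * (2 * γ)) + L * B * 2) := by gcongr
    _ = _ := by rw [hn]; push_cast; ring

/-- The pigeonhole bound for a single interaction per step. -/
theorem sum_self_interaction_le {d k : ℕ} (hk : 1 ≤ k) (w y : ℕ → Fin d → ℝ) {γ Rw Rx : ℝ}
    (hγ : 0 ≤ γ) (hRx : 0 ≤ Rx) (hB : 0 < Rx * Rw) (hw : ∀ t < k, ∀ l, |w t l| ≤ Rw)
    (hy : ∀ t < k, ∑ l, |y t l| ≤ Rx) (hself : ∀ t < k, w t ⬝ᵥ y t ≤ Rx * Rw)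
    (hpast : ∀ t < k, ∑ s ∈ range t, |w t ⬝ᵥ y s| ≤ γ) :
    ∑ t ∈ range k, w t ⬝ᵥ y t ≤ 24 * (d * (1 + Real.log k) ^ 2 * (γ + Rx * Rw)) := by
  set B := Rx * Rw with hBdef
  have hk' : (1 : ℝ) ≤ k := by exact_mod_cast hk
  have hlogk : 0 ≤ Real.log k := Real.log_nonneg hk'
  rcases Nat.eq_zero_or_pos d with rfl | hd
  · simp [dotProduct]
  have hd' : (1 : ℝ) ≤ d := by exact_mod_cast hd
  have hlog32 : (2 / 5 : ℝ) ≤ Real.log (3 / 2) := by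
    rw [Real.le_log_iff_exp_le (by norm_num)]
    have h1 : Real.exp 1 < 2.7182818286 := Real.exp_one_lt_d9
    have h2 : Real.exp (2 / 5) ^ 5 = Real.exp 1 ^ 2 := by
      rw [← Real.exp_nat_mul, ← Real.exp_nat_mul]
      norm_num
    by_contra h
    push Not at h
    have h3 : (3 / 2 : ℝ) ^ 5 < Real.exp (2 / 5) ^ 5 :=
      pow_lt_pow_left₀ h (by norm_num) (by norm_num)
    rw [h2] at h3
    nlinarith [Real.exp_pos 1]
  have hlog2 : (2 / 3 : ℝ) ≤ Real.log 2 := by linarith [Real.log_two_gt_d9]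
  set L : ℝ := d * (3 * (1 + Real.log k)) / (2 / 5) with hLdef
  have hL : 0 ≤ L := by positivity
  have hpowk : ((2 : ℝ) ^ Nat.log 2 k) ≤ k := by
    exact_mod_cast Nat.pow_log_le_self 2 (by omega)
  have hI : ((Nat.log 2 k : ℕ) : ℝ) ≤ 3 / 2 * Real.log k := by
    have h1 := Real.log_le_log (by positivity) hpowk
    rw [Real.log_pow] at h1
    nlinarith [Nat.cast_nonneg (α := ℝ) (Nat.log 2 k)]
  have hlarge := sum_le_of_card_large_le (fun t => w t ⬝ᵥ y t) hB hself hL (γ := γ) (by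
    intro i hi
    have hε : 0 < B / 2 ^ (i + 1) := by positivity
    refine (card_large_le k w y hε hγ hRx hw hy hpast).trans ?_
    have hratio : B / (B / 2 ^ (i + 1)) ≤ 2 * k := by
      rw [div_div_cancel₀ hB.ne', pow_succ]
      have : (2 : ℝ) ^ i ≤ 2 ^ Nat.log 2 k := pow_le_pow_right₀ (by norm_num) hi
      linarith
    have hlog : Real.log (1 + k * (B / (B / 2 ^ (i + 1))) ^ 2) ≤ 3 * (1 + Real.log k) := by
      have h5 : 1 + k * (B / (B / 2 ^ (i + 1))) ^ 2 ≤ 5 * (k : ℝ) ^ 3 := by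
        have h6 : (B / (B / 2 ^ (i + 1))) ^ 2 ≤ (2 * k) ^ 2 :=
          pow_le_pow_left₀ (by positivity) hratio 2
        have h7 : (1 : ℝ) ≤ (k : ℝ) ^ 3 := one_le_pow₀ hk'
        nlinarith
      refine (Real.log_le_log (by positivity) h5).trans ?_
      rw [Real.log_mul (by norm_num) (by positivity), Real.log_pow]
      have h8 : Real.log 5 ≤ 3 := by
        rw [Real.log_le_iff_le_exp (by norm_num)]
        have := Real.add_one_le_exp (3 / 2 : ℝ)
        have h9 : Real.exp 3 = Real.exp (3 / 2) ^ 2 := by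
          rw [← Real.exp_nat_mul]
          norm_num
        rw [h9]
        nlinarith
      push_cast
      linarith
    refine mul_le_mul_of_nonneg_left ?_ (by positivity)
    rw [hLdef]
    gcongr)
  refine hlarge.trans ?_
  have h1 : ((Nat.log 2 k : ℕ) + 1 : ℝ) * (2 * γ) + 2 * B ≤ 3 * (1 + Real.log k) * (γ + B) := by
    nlinarith [mul_nonneg hlogk hγ, mul_nonneg hlogk hB.le]
  have h2 : B ≤ d * (1 + Real.log k) ^ 2 * (γ + B) := by
    have : 1 ≤ d * (1 + Real.log k) ^ 2 := by nlinarith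
    nlinarith
  have h3 := mul_le_mul_of_nonneg_left h1 hL
  have h4 : L * (3 * (1 + Real.log k) * (γ + B)) =
      45 / 2 * (d * (1 + Real.log k) ^ 2 * (γ + B)) := by
    rw [hLdef]
    ring
  have h5 : 0 ≤ d * (1 + Real.log k) ^ 2 * (γ + B) := by positivity
  linarith

end

/-! ### Families of vectors -/

section

open Matrix Finset

theorem abs_dotProduct_le {d : ℕ} (x v : Fin d → ℝ) : |x ⬝ᵥ v| ≤ (∑ l, |x l|) * ‖v‖ := by
  rw [sum_mul]
  refine (abs_sum_le_sum_abs _ _).trans (sum_le_sum fun l _ => ?_)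
  rw [abs_mul]
  exact mul_le_mul_of_nonneg_left (norm_le_pi_norm v l) (abs_nonneg _)

/-- Collapsing two families of vectors to one pair. Some multiple `w` of one of the `v j`, paired
with a signed sum of the `x i`, already realizes the whole interaction, at the price of a factor
`2` in the norm of `w` and in the value at `w` of a given homogeneous function `a`: a weighted
average of the `v j` satisfies these bounds, so one of them does. -/
theorem exists_collapse {d m n : ℕ} (x : Fin m → Fin d → ℝ) (v : Fin n → Fin d → ℝ)
    (a : (Fin d → ℝ) → ℝ) (ha0 : ∀ u, 0 ≤ a u)
    (ha : ∀ c : ℝ, 0 ≤ c → ∀ u, a (c • u) = c * a u)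
    {γ G : ℝ} (hγ : 0 < γ) (hG : 0 < G) (haγ : ∑ j, a (v j) ≤ γ) (hvG : ∑ j, ‖v j‖ ≤ G) :
    ∃ (w : Fin d → ℝ) (σ : Fin m → ℝ), (∀ i, |σ i| ≤ 1) ∧
      w ⬝ᵥ (∑ i, σ i • x i) = ∑ i, ∑ j, |x i ⬝ᵥ v j| ∧ a w ≤ 2 * γ ∧ ‖w‖ ≤ 2 * G := by
  set M := ∑ i, ∑ j, |x i ⬝ᵥ v j| with hM
  have hM0 : 0 ≤ M := sum_nonneg fun i _ => sum_nonneg fun j _ => abs_nonneg _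
  rcases hM0.eq_or_lt with h0 | hpos
  · refine ⟨0, 0, fun i => by simp, by simp [← h0], ?_, by simpa using hG.le⟩
    have := ha 0 le_rfl 0
    rw [zero_smul, zero_mul] at this
    rw [this]
    positivity
  have hMb : M = ∑ j, ∑ i, |x i ⬝ᵥ v j| := sum_comm
  have hex : ∃ j, 0 < ∑ i, |x i ⬝ᵥ v j| ∧
      M * (a (v j) / (2 * γ) + ‖v j‖ / (2 * G)) ≤ ∑ i, |x i ⬝ᵥ v j| := by
    by_contra hcon
    push Not at hcon
    have hb0 : ∀ j, 0 ≤ ∑ i, |x i ⬝ᵥ v j| := fun j => sum_nonneg fun i _ => abs_nonneg _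
    obtain ⟨j₀, -, hj₀⟩ : ∃ j ∈ univ, 0 < ∑ i, |x i ⬝ᵥ v j| := by
      by_contra h
      push Not at h
      have := sum_nonpos h
      linarith
    have hlt : ∑ j, ∑ i, |x i ⬝ᵥ v j| <
        ∑ j, M * (a (v j) / (2 * γ) + ‖v j‖ / (2 * G)) := by
      refine sum_lt_sum (fun j _ => ?_) ⟨j₀, mem_univ j₀, hcon j₀ hj₀⟩
      rcases (hb0 j).eq_or_lt with h | h
      · rw [← h]
        have := ha0 (v j)
        positivity
      · exact (hcon j h).le
    have hle : ∑ j, M * (a (v j) / (2 * γ) + ‖v j‖ / (2 * G)) ≤ M := by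
      rw [← mul_sum, sum_add_distrib, ← sum_div, ← sum_div]
      have h1 : (∑ j, a (v j)) / (2 * γ) ≤ 1 / 2 := by
        rw [div_le_iff₀ (by positivity)]
        linarith
      have h2 : (∑ j, ‖v j‖) / (2 * G) ≤ 1 / 2 := by
        rw [div_le_iff₀ (by positivity)]
        linarith
      nlinarith
    rw [← hMb] at hlt
    exact absurd (hlt.trans_le hle) (lt_irrefl _)
  obtain ⟨j, hb, hj⟩ := hex
  set b := ∑ i, |x i ⬝ᵥ v j| with hbdef
  have hab : M * a (v j) ≤ 2 * γ * b := by
    have h1 : M * (a (v j) / (2 * γ)) ≤ b := by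
      have : 0 ≤ M * (‖v j‖ / (2 * G)) := by positivity
      linarith
    rw [← mul_div_assoc, div_le_iff₀ (by positivity)] at h1
    linarith
  have hvb : M * ‖v j‖ ≤ 2 * G * b := by
    have h1 : M * (‖v j‖ / (2 * G)) ≤ b := by
      have : 0 ≤ M * (a (v j) / (2 * γ)) := by
        have := ha0 (v j)
        positivity
      linarith
    rw [← mul_div_assoc, div_le_iff₀ (by positivity)] at h1
    linarith
  -- Rescaling `v j` restores the full interaction `M`; the signs make its terms add up.
  refine ⟨(M / b) • v j, fun i => SignType.sign (x i ⬝ᵥ v j), fun i => ?_, ?_, ?_, ?_⟩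
  · rcases lt_trichotomy (x i ⬝ᵥ v j) 0 with h | h | h
    · simp [sign_neg h]
    · simp [h]
    · simp [sign_pos h]
  · rw [smul_dotProduct, dotProduct_sum]
    have : ∑ i, v j ⬝ᵥ ((SignType.sign (x i ⬝ᵥ v j) : ℝ) • x i) = b := by
      refine sum_congr rfl fun i _ => ?_
      rw [dotProduct_smul, dotProduct_comm (v j), smul_eq_mul, sign_mul_self]
    rw [this, smul_eq_mul, div_mul_cancel₀ _ hb.ne']
  · rw [ha _ (by positivity), div_mul_eq_mul_div, div_le_iff₀ hb]
    exact hab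
  · rw [norm_smul, Real.norm_of_nonneg (by positivity), div_mul_eq_mul_div, div_le_iff₀ hb]
    exact hvb

/-- The pigeonhole bound for families of vectors. It does not involve the sizes of the families,
and `B` bounds products of `ℓ¹` norms with `ℓ^∞` norms without a further power of `d`. -/
theorem sum_self_interaction_family_le {d m n k : ℕ} (hk : 1 ≤ k)
    (f : ℕ → Fin m → Fin d → ℝ) (g : ℕ → Fin n → Fin d → ℝ) {γ B : ℝ} (hγ : 0 ≤ γ)
    (hB : ∀ s < k, ∀ t < k, (∑ i, ∑ l, |f s i l|) * (∑ j, ‖g t j‖) ≤ B)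
    (hpast : ∀ t < k, ∑ s ∈ range t, ∑ i, ∑ j, |f s i ⬝ᵥ g t j| ≤ γ) :
    ∑ t ∈ range k, ∑ i, ∑ j, |f t i ⬝ᵥ g t j| ≤
      96 * (d * (1 + Real.log k) ^ 2 * (γ + B)) := by
  have hne : (range k).Nonempty := ⟨0, mem_range.2 hk⟩
  obtain ⟨s₀, hs₀, hF⟩ := exists_max_image (range k) (fun s => ∑ i, ∑ l, |f s i l|) hne
  obtain ⟨t₀, ht₀, hG⟩ := exists_max_image (range k) (fun t => ∑ j, ‖g t j‖) hne
  set F := ∑ i, ∑ l, |f s₀ i l|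
  set G := ∑ j, ‖g t₀ j‖
  have hF0 : 0 ≤ F := sum_nonneg fun i _ => sum_nonneg fun l _ => abs_nonneg _
  have hG0 : 0 ≤ G := sum_nonneg fun j _ => norm_nonneg _
  have hFG : F * G ≤ B := hB s₀ (mem_range.1 hs₀) t₀ (mem_range.1 ht₀)
  have hself : ∀ t < k, ∑ i, ∑ j, |f t i ⬝ᵥ g t j| ≤ F * G := by
    intro t ht
    calc ∑ i, ∑ j, |f t i ⬝ᵥ g t j| ≤ ∑ i, ∑ j, (∑ l, |f t i l|) * ‖g t j‖ :=
          sum_le_sum fun i _ => sum_le_sum fun j _ => abs_dotProduct_le _ _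
      _ = (∑ i, ∑ l, |f t i l|) * ∑ j, ‖g t j‖ := (sum_mul_sum _ _ _ _).symm
      _ ≤ F * G := mul_le_mul (hF t (mem_range.2 ht)) (hG t (mem_range.2 ht))
          (sum_nonneg fun j _ => norm_nonneg _) hF0
  have hB0 : 0 ≤ B := (mul_nonneg hF0 hG0).trans hFG
  have hlogk : 0 ≤ Real.log k := Real.log_nonneg (by exact_mod_cast hk)
  rcases (mul_nonneg hF0 hG0).eq_or_lt with h0 | hpos
  · calc ∑ t ∈ range k, ∑ i, ∑ j, |f t i ⬝ᵥ g t j| ≤ ∑ _t ∈ range k, (0 : ℝ) :=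
          sum_le_sum fun t ht => (hself t (mem_range.1 ht)).trans h0.ge
      _ = 0 := by simp
      _ ≤ _ := by positivity
  have hGpos : 0 < G := by
    rcases hG0.eq_or_lt with h | h
    · rw [← h, mul_zero] at hpos
      exact absurd hpos (lt_irrefl _)
    · exact h
  have hch : ∀ t, ∃ (w : Fin d → ℝ) (σ : Fin m → ℝ), (∀ i, |σ i| ≤ 1) ∧ (t < k →
      w ⬝ᵥ (∑ i, σ i • f t i) = ∑ i, ∑ j, |f t i ⬝ᵥ g t j| ∧
      ∑ s ∈ range t, ∑ i, |f s i ⬝ᵥ w| ≤ 2 * (γ + B) ∧ ‖w‖ ≤ 2 * G) := by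
    intro t
    by_cases ht : t < k
    · obtain ⟨w, σ, h1, h2⟩ := exists_collapse (f t) (g t)
        (fun w => ∑ s ∈ range t, ∑ i, |f s i ⬝ᵥ w|)
        (fun u => sum_nonneg fun s _ => sum_nonneg fun i _ => abs_nonneg _)
        (fun c hc u => by
          simp only [dotProduct_smul, smul_eq_mul, abs_mul, abs_of_nonneg hc, mul_sum])
        (γ := γ + B) (by linarith) hGpos
        (by
          refine le_trans (le_of_eq ?_) ((hpast t ht).trans (le_add_of_nonneg_right hB0))
          rw [sum_comm]
          exact sum_congr rfl fun s _ => sum_comm)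
        (hG t (mem_range.2 ht))
      exact ⟨w, σ, h1, fun _ => h2⟩
    · exact ⟨0, 0, fun i => by simp, fun h => absurd h ht⟩
  choose w σ hσ hwσ using hch
  have hdot : ∀ (s : ℕ) (v : Fin d → ℝ), |v ⬝ᵥ (∑ i, σ s i • f s i)| ≤ ∑ i, |f s i ⬝ᵥ v| := by
    intro s v
    rw [dotProduct_sum]
    refine (abs_sum_le_sum_abs _ _).trans (sum_le_sum fun i _ => ?_)
    rw [dotProduct_smul, smul_eq_mul, abs_mul, dotProduct_comm v]
    exact mul_le_of_le_one_left (abs_nonneg _) (hσ s i)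
  have key := sum_self_interaction_le hk w (fun t => ∑ i, σ t i • f t i)
    (γ := 2 * (γ + B)) (Rw := 2 * G) (Rx := F) (by positivity) hF0 (by nlinarith)
    (fun t ht l => (norm_le_pi_norm (w t) l).trans (hwσ t ht).2.2)
    (fun t ht => by
      refine le_trans ?_ (hF t (mem_range.2 ht))
      rw [sum_comm]
      refine sum_le_sum fun l _ => ?_
      rw [Finset.sum_apply]
      refine (abs_sum_le_sum_abs _ _).trans (sum_le_sum fun i _ => ?_)
      rw [Pi.smul_apply, smul_eq_mul, abs_mul]
      exact mul_le_of_le_one_left (abs_nonneg _) (hσ t i))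
    (fun t ht => by
      rw [(hwσ t ht).1]
      have := hself t ht
      linarith)
    (fun t ht => (sum_le_sum fun s _ => hdot s (w t)).trans (hwσ t ht).2.1)
  rw [sum_congr rfl fun t ht => (hwσ t (mem_range.1 ht)).1] at key
  refine key.trans ?_
  have h1 : 2 * (γ + B) + F * (2 * G) ≤ 4 * (γ + B) := by linarith
  have h2 : 0 ≤ d * (1 + Real.log k) ^ 2 := by positivity
  nlinarith [mul_le_mul_of_nonneg_left h1 h2]

end

/-! ### From the SAIL condition to the generalized eluder-type condition -/

section

open Finset

variable {O A : Type*} [MeasurableSpace O] [MeasurableSpace A] [Fintype A] {H : ℕ}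
  {ν : Measure O}

theorem tvDist_comm (P Q : Dynamics O A H ν) (π : Policy O A H) :
    tvDist P Q π = tvDist Q P π := by
  simp only [tvDist, abs_sub_comm]

theorem tvDist_nonneg (P Q : Dynamics O A H ν) (π : Policy O A H) : 0 ≤ tvDist P Q π :=
  mul_nonneg (by norm_num) (integral_nonneg fun _ => abs_nonneg _)

theorem list_sum_map_sq_le {α : Type*} (l : List α) (f : α → ℝ) :
    (l.map f).sum ^ 2 ≤ l.length * (l.map fun x => f x ^ 2).sum := by
  rw [← Fin.sum_univ_fun_getElem, ← Fin.sum_univ_fun_getElem]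
  simpa using sq_sum_le_card_mul_sum_sq (s := univ) (f := fun i : Fin l.length => f l[i])

theorem list_sum_map_nonneg {α : Type*} (l : List α) {f : α → ℝ} (hf : ∀ x, 0 ≤ f x) :
    0 ≤ (l.map f).sum :=
  List.sum_nonneg (by simpa using fun x _ => hf x)

/-- The generalized eluder-type bound under the SAIL condition, with explicit constants. -/
theorem sum_tvDist_le_of_SAIL {Θ : Type*} {P : Θ → Dynamics O A H ν} {θstar : Θ}
    {greedy : Θ → Policy O A H} {expl : Policy O A H → List (Policy O A H)} {N d : ℕ} {κ B : ℝ}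
    (hN : ∀ π, (expl π).length ≤ N) (hS : SAIL P θstar greedy expl d κ B) {Δ : ℝ}
    (θ : ℕ → Θ) {k : ℕ} (hk : 1 ≤ k)
    (hΔ : ∀ t < k, ∑ s ∈ range t,
      ((expl (greedy (θ s))).map fun π => tvDist (P (θ t)) (P θstar) π ^ 2).sum ≤ Δ) :
    ∑ t ∈ range k, tvDist (P (θ t)) (P θstar) (greedy (θ t)) ≤
      (H + 1) * (96 * (d * (1 + Real.log k) ^ 2 * (|κ| * Real.sqrt (k * N * Δ) + B))) := by
  obtain ⟨m, n, f, g, h1, h2, h3⟩ := hS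
  have hΔ0 : 0 ≤ Δ := by simpa using hΔ 0 hk
  have hγ : ∀ t < k, ∑ s ∈ range t, κ *
      ((expl (greedy (θ s))).map fun π => tvDist (P θstar) (P (θ t)) π).sum ≤
        |κ| * Real.sqrt (k * N * Δ) := by
    intro t ht
    set a : ℕ → ℝ := fun s => ((expl (greedy (θ s))).map fun π => tvDist (P θstar) (P (θ t)) π).sum
      with ha
    have ha0 : ∀ s, 0 ≤ a s := fun s => list_sum_map_nonneg _ fun π => tvDist_nonneg _ _ _
    have hsq : (∑ s ∈ range t, a s) ^ 2 ≤ k * N * Δ := by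
      calc (∑ s ∈ range t, a s) ^ 2 ≤ t * ∑ s ∈ range t, a s ^ 2 := by
            simpa using sq_sum_le_card_mul_sum_sq (s := range t) (f := a)
        _ ≤ k * ∑ s ∈ range t, N *
              ((expl (greedy (θ s))).map fun π => tvDist (P (θ t)) (P θstar) π ^ 2).sum := by
            refine mul_le_mul (by exact_mod_cast ht.le) (sum_le_sum fun s _ => ?_)
              (sum_nonneg fun s _ => sq_nonneg _) (Nat.cast_nonneg _)
            refine (list_sum_map_sq_le _ _).trans ?_
            simp only [tvDist_comm (P θstar)]
            exact mul_le_mul_of_nonneg_right (by exact_mod_cast hN _)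
              (list_sum_map_nonneg _ fun π => sq_nonneg _)
        _ ≤ k * N * Δ := by
            rw [← mul_sum, ← mul_assoc]
            exact mul_le_mul_of_nonneg_left (hΔ t ht) (by positivity)
    rw [← mul_sum]
    have h4 : ∑ s ∈ range t, a s ≤ Real.sqrt (k * N * Δ) := Real.le_sqrt_of_sq_le hsq
    exact mul_le_mul (le_abs_self κ) h4 (sum_nonneg fun s _ => ha0 s) (abs_nonneg κ)
  have hh : ∀ h, ∑ t ∈ range k, ∑ i, ∑ j, |∑ l, f h i (θ t) l * g h j (θ t) l| ≤
      96 * (d * (1 + Real.log k) ^ 2 * (|κ| * Real.sqrt (k * N * Δ) + B)) := by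
    intro h
    refine sum_self_interaction_family_le hk (fun t i => f h i (θ t)) (fun t j => g h j (θ t))
      (by positivity) (fun s _ t _ => h3 h (θ s) (θ t)) fun t ht => ?_
    refine le_trans (sum_le_sum fun s _ => ?_) (hγ t ht)
    exact (single_le_sum (f := fun h => ∑ i, ∑ j, |∑ l, f h i (θ s) l * g h j (θ t) l|)
      (fun h _ => sum_nonneg fun i _ => sum_nonneg fun j _ => abs_nonneg _) (mem_univ h)).trans
      (h2 (θ s) (θ t))
  calc ∑ t ∈ range k, tvDist (P (θ t)) (P θstar) (greedy (θ t))
      ≤ ∑ t ∈ range k, ∑ h, ∑ i, ∑ j, |∑ l, f h i (θ t) l * g h j (θ t) l| :=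
        sum_le_sum fun t _ => by rw [tvDist_comm]; exact h1 (θ t)
    _ = ∑ h, ∑ t ∈ range k, ∑ i, ∑ j, |∑ l, f h i (θ t) l * g h j (θ t) l| := sum_comm
    _ ≤ ∑ _h : Fin (H + 1),
          96 * (d * (1 + Real.log k) ^ 2 * (|κ| * Real.sqrt (k * N * Δ) + B)) :=
        sum_le_sum fun h _ => hh h
    _ = _ := by simp

theorem SAIL.bound_nonneg {Θ : Type*} {P : Θ → Dynamics O A H ν} {θstar : Θ}
    {greedy : Θ → Policy O A H} {expl : Policy O A H → List (Policy O A H)} {d : ℕ} {κ B : ℝ}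
    (hS : SAIL P θstar greedy expl d κ B) : 0 ≤ B := by
  obtain ⟨m, n, f, g, -, -, h3⟩ := hS
  refine le_trans (mul_nonneg ?_ ?_) (h3 0 θstar θstar)
  · exact sum_nonneg fun i _ => sum_nonneg fun l _ => abs_nonneg _
  · exact sum_nonneg fun j _ => norm_nonneg _

/-- The explicit bound of `sum_tvDist_le_of_SAIL`, enlarged by a factor `2 H` and with `6 Δ` in
place of `Δ`, is dominated by `sailBound`. -/
theorem explicit_bound_le_sailBound {H : ℕ} (hH : 1 ≤ H) {d k N : ℕ} (hk : 1 ≤ k) (κ : ℝ)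
    {B Δ : ℝ} (hB : 0 ≤ B) (hΔ : 0 ≤ Δ) :
    2 * H * ((H + 1) * (96 * (d * (1 + Real.log k) ^ 2 *
        (|κ| * Real.sqrt (k * N * (6 * Δ)) + B)))) ≤
      sailBound 1200 4 H d B (sailDim 1200 4 H d κ N) k Δ N := by
  have hH' : (1 : ℝ) ≤ H := by exact_mod_cast hH
  have hlogk : 0 ≤ Real.log k := Real.log_nonneg (by exact_mod_cast hk)
  have hs : 34 * (H : ℝ) ^ 2 * d * |κ| * Real.sqrt (k * N * Δ) ≤
      Real.sqrt (sailDim 1200 4 H d κ N * Δ * N * k) := by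
    refine Real.le_sqrt_of_sq_le ?_
    have h1 : 0 ≤ (k : ℝ) * N * Δ := by positivity
    rw [mul_pow, Real.sq_sqrt h1, mul_pow, sq_abs]
    rw [sailDim]
    rcases Nat.eq_zero_or_pos N with rfl | hN
    · simp
    have hN' : (1 : ℝ) ≤ N := by exact_mod_cast hN
    have h2 : 0 ≤ κ ^ 2 * d ^ 2 * (H : ℝ) ^ 4 * (k * N * Δ) := by positivity
    calc (34 * (H : ℝ) ^ 2 * d) ^ 2 * κ ^ 2 * (k * N * Δ)
        = 1156 * (κ ^ 2 * d ^ 2 * (H : ℝ) ^ 4 * (k * N * Δ)) := by ring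
      _ ≤ 1200 * N * (κ ^ 2 * d ^ 2 * (H : ℝ) ^ 4 * (k * N * Δ)) :=
          mul_le_mul_of_nonneg_right (by linarith) h2
      _ = _ := by ring
  have hs6 : Real.sqrt (k * N * (6 * Δ)) ≤ 5 / 2 * Real.sqrt (k * N * Δ) := by
    rw [show (k : ℝ) * N * (6 * Δ) = 6 * (k * N * Δ) by ring, Real.sqrt_mul (by norm_num)]
    refine mul_le_mul_of_nonneg_right ?_ (Real.sqrt_nonneg _)
    rw [Real.sqrt_le_left (by norm_num)]
    norm_num
  have hHH : 2 * (H : ℝ) * (H + 1) ≤ 4 * (H : ℝ) ^ 2 := by nlinarith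
  have hH4 : (H : ℝ) ^ 2 ≤ (H : ℝ) ^ 4 := pow_le_pow_right₀ hH' (by norm_num)
  set S := Real.sqrt (k * N * Δ)
  have hS0 : 0 ≤ S := Real.sqrt_nonneg _
  rw [sailBound]
  calc _ = 2 * (H : ℝ) * (H + 1) * (96 * (1 + Real.log k) ^ 2 *
            (d * (|κ| * Real.sqrt (k * N * (6 * Δ)) + B))) := by ring
    _ ≤ 4 * (H : ℝ) ^ 2 * (96 * (1 + Real.log k) ^ 2 * (d * (|κ| * (5 / 2 * S) + B))) := by
        gcongr
    _ = 96 * (1 + Real.log k) ^ 2 *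
          (10 / 34 * (34 * (H : ℝ) ^ 2 * d * |κ| * S) + d * B * (4 * (H : ℝ) ^ 2)) := by ring
    _ ≤ 1200 * (1 + Real.log k) ^ 2 *
          (1 * Real.sqrt (sailDim 1200 4 H d κ N * Δ * N * k) + d * B * (1200 * (H : ℝ) ^ 4)) := by
        gcongr <;> norm_num
    _ = _ := by ring

theorem eluderCondition_of_SAIL (hH : 1 ≤ H) {Θ : Type*} {P : Θ → Dynamics O A H ν} {θstar : Θ}
    {greedy : Θ → Policy O A H} {expl : Policy O A H → List (Policy O A H)} {N d : ℕ} {κ B : ℝ}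
    (hN : ∀ π, (expl π).length ≤ N) (hS : SAIL P θstar greedy expl d κ B) :
    EluderCondition P θstar greedy expl N (sailDim 1200 4 H d κ N) (sailBound 1200 4 H d B) := by
  intro K Δ hΔ θ hθ k hk hkK
  have hB := hS.bound_nonneg
  have hlogk : 0 ≤ Real.log k := Real.log_nonneg (by exact_mod_cast hk)
  refine le_trans ?_ (explicit_bound_le_sailBound hH hk κ hB hΔ)
  refine (sum_tvDist_le_of_SAIL hN hS θ hk fun t ht => (hθ t (ht.trans_le hkK)).trans
    (show Δ ≤ 6 * Δ by linarith)).trans ?_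
  refine le_mul_of_one_le_left (by positivity) ?_
  have : (1 : ℝ) ≤ H := by exact_mod_cast hH
  linarith

end

/-! ### Trajectory laws and values -/

section

open Finset

theorem measurable_past {O A : Type*} [MeasurableSpace O] [MeasurableSpace A] {H : ℕ}
    (h : Fin H) : Measurable fun τ : Traj O A H => past τ h :=
  measurable_pi_lambda _ fun _ => measurable_pi_apply _

theorem past_snoc {O A : Type*} {n : ℕ} (τ : Traj O A n) (z : O × A) (h : Fin n) :
    past (Fin.snoc (α := fun _ => O × A) τ z : Traj O A (n + 1)) h.castSucc = past τ h := by
  funext i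
  have hi : (i : ℕ) < n := i.2.trans h.2
  simp only [past, Fin.snoc, hi, dif_pos]
  rfl

theorem past_snoc_last {O A : Type*} {n : ℕ} (τ : Traj O A n) (z : O × A) :
    past (Fin.snoc (α := fun _ => O × A) τ z : Traj O A (n + 1)) (Fin.last n) = τ := by
  funext i
  have hi : (i : ℕ) < n := i.2
  simp only [past, Fin.snoc, hi, dif_pos]
  rfl

/-- Conditional densities multiply to a probability density. -/
theorem lintegral_prod_conditional {O A : Type*} [MeasurableSpace O] [MeasurableSpace A]
    (μ : Measure (O × A)) [SigmaFinite μ] :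
    ∀ (H : ℕ) (q : (h : Fin H) → (Fin (h : ℕ) → O × A) → O × A → ENNReal)
      (_ : ∀ h : Fin H, Measurable fun z : (Fin (h : ℕ) → O × A) × (O × A) => q h z.1 z.2)
      (_ : ∀ h x, ∫⁻ z, q h x z ∂μ = 1),
      ∫⁻ τ : Traj O A H, ∏ h, q h (past τ h) (τ h) ∂(Measure.pi fun _ => μ) = 1
  | 0, q, _, _ => by simp
  | n + 1, q, hq, hq1 => by
    have ih := lintegral_prod_conditional μ n (fun h => q h.castSucc) (fun h => hq h.castSucc)
      (fun h => hq1 h.castSucc)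
    have hlast : Measurable fun z : Traj O A n × (O × A) => q (Fin.last n) z.1 z.2 :=
      hq (Fin.last n)
    have hmeas : Measurable fun τ : Traj O A n => ∏ h : Fin n, q h.castSucc (past τ h) (τ h) :=
      Finset.measurable_fun_prod _ fun h _ =>
        (hq h.castSucc).comp ((measurable_past h).prodMk (measurable_pi_apply h))
    have hmp := measurePreserving_piFinSuccAbove (fun _ : Fin (n + 1) => μ) (Fin.last n)
    rw [← hmp.symm.lintegral_comp_emb (MeasurableEquiv.measurableEmbedding _)]
    have hint : ∀ z : (O × A) × Traj O A n,
        (∏ h, q h (past ((MeasurableEquiv.piFinSuccAbove (fun _ => O × A) (Fin.last n)).symm z) h)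
          ((MeasurableEquiv.piFinSuccAbove (fun _ => O × A) (Fin.last n)).symm z h)) =
        (∏ h : Fin n, q h.castSucc (past z.2 h) (z.2 h)) * q (Fin.last n) z.2 z.1 := by
      intro z
      have hz : (MeasurableEquiv.piFinSuccAbove (fun _ => O × A) (Fin.last n)).symm z =
          Fin.snoc (α := fun _ => O × A) z.2 z.1 := by
        simp [MeasurableEquiv.piFinSuccAbove, Fin.insertNthEquiv]
      rw [hz, Fin.prod_univ_castSucc, past_snoc_last]
      simp only [past_snoc, Fin.snoc_last, Fin.snoc_castSucc]
    simp only [hint]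
    rw [lintegral_prod_symm]
    · simp only
      calc _ = ∫⁻ τ : Traj O A n, ∏ h : Fin n, q h.castSucc (past τ h) (τ h)
            ∂(Measure.pi fun _ => μ) := by
            refine lintegral_congr fun τ => ?_
            have hτ : Measurable fun z : O × A => q (Fin.last n) τ z :=
              hlast.comp (measurable_const.prodMk measurable_id)
            rw [lintegral_const_mul _ hτ]
            rw [hq1 (Fin.last n) τ, mul_one]
        _ = 1 := ih
    · exact ((hmeas.comp measurable_snd).mul
        (hlast.comp (measurable_snd.prodMk measurable_fst))).aemeasurable

variable {O A : Type*} [MeasurableSpace O] [MeasurableSpace A] [Fintype A] {H : ℕ}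
  {ν : Measure O}

theorem Dynamics.obsDensity_nonneg (P : Dynamics O A H ν) (τ : Traj O A H) :
    0 ≤ P.obsDensity τ :=
  prod_nonneg fun h _ => P.nonneg h _ _

theorem Policy.weight_nonneg (π : Policy O A H) (τ : Traj O A H) : 0 ≤ π.weight τ :=
  prod_nonneg fun h _ => π.nonneg h _ _ _

theorem trajDensity_nonneg (P : Dynamics O A H ν) (π : Policy O A H) (τ : Traj O A H) :
    0 ≤ trajDensity P π τ :=
  mul_nonneg (P.obsDensity_nonneg τ) (π.weight_nonneg τ)

theorem Dynamics.measurable_obsDensity (P : Dynamics O A H ν) : Measurable P.obsDensity :=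
  Finset.measurable_fun_prod _ fun h _ =>
    (P.measurable h).comp ((measurable_past h).prodMk (measurable_fst.comp (measurable_pi_apply h)))

variable [MeasurableSingletonClass A]

theorem Policy.measurable_prob (π : Policy O A H) (h : Fin H) :
    Measurable fun z : (Fin (h : ℕ) → O × A) × (O × A) => π.prob h z.1 z.2.1 z.2.2 := by
  have : Measurable fun z : ((Fin (h : ℕ) → O × A) × O) × A => π.prob h z.1.1 z.1.2 z.2 :=
    measurable_from_prod_countable_left fun a => π.measurable h a
  exact this.comp ((measurable_fst.prodMk (measurable_fst.comp measurable_snd)).prodMk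
    (measurable_snd.comp measurable_snd))

theorem Policy.measurable_weight (π : Policy O A H) : Measurable π.weight :=
  Finset.measurable_fun_prod _ fun h _ =>
    (π.measurable_prob h).comp ((measurable_past h).prodMk (measurable_pi_apply h))

theorem measurable_trajDensity (P : Dynamics O A H ν) (π : Policy O A H) :
    Measurable (trajDensity P π) :=
  P.measurable_obsDensity.mul π.measurable_weight

variable [SigmaFinite ν]

instance : SigmaFinite (refMeasure A H ν) := by
  unfold refMeasure
  infer_instance

theorem lintegral_trajDensity (P : Dynamics O A H ν) (π : Policy O A H) :
    ∫⁻ τ, ENNReal.ofReal (trajDensity P π τ) ∂(refMeasure A H ν) = 1 := by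
  have h := lintegral_prod_conditional (ν.prod (Measure.count : Measure A)) H
    (fun h x z => ENNReal.ofReal (P.dens h x z.1 * π.prob h x z.1 z.2))
    (fun h => (((P.measurable h).comp (measurable_fst.prodMk (measurable_fst.comp measurable_snd))).mul
      (π.measurable_prob h)).ennreal_ofReal)
    (fun h x => by
      have hd : Measurable fun o => P.dens h x o :=
        (P.measurable h).comp (measurable_const.prodMk measurable_id)
      have hp : Measurable fun z : O × A => π.prob h x z.1 z.2 :=
        (π.measurable_prob h).comp (measurable_const.prodMk measurable_id)
      have hdp : Measurable fun z : O × A => ENNReal.ofReal (P.dens h x z.1 * π.prob h x z.1 z.2) :=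
        ((hd.comp measurable_fst).mul hp).ennreal_ofReal
      rw [lintegral_prod _ hdp.aemeasurable, ← P.normalized h x]
      refine lintegral_congr fun o => ?_
      rw [lintegral_count, tsum_fintype]
      simp only [ENNReal.ofReal_mul (P.nonneg h x o)]
      rw [← Finset.mul_sum, ← ENNReal.ofReal_sum_of_nonneg fun a _ => π.nonneg h x o a,
        π.sum_eq_one, ENNReal.ofReal_one, mul_one])
  rw [← h]
  refine lintegral_congr fun τ => ?_
  rw [← ENNReal.ofReal_prod_of_nonneg fun h _ => mul_nonneg (P.nonneg h _ _) (π.nonneg h _ _ _),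
    prod_mul_distrib]
  rfl

instance (P : Dynamics O A H ν) (π : Policy O A H) : IsProbabilityMeasure (trajLaw P π) :=
  ⟨by rw [trajLaw, withDensity_apply _ MeasurableSet.univ, Measure.restrict_univ,
    lintegral_trajDensity]⟩

theorem integrable_trajDensity (P : Dynamics O A H ν) (π : Policy O A H) :
    Integrable (trajDensity P π) (refMeasure A H ν) := by
  refine ⟨(measurable_trajDensity P π).aestronglyMeasurable, ?_⟩
  rw [hasFiniteIntegral_iff_ofReal (Filter.Eventually.of_forall (trajDensity_nonneg P π)),
    lintegral_trajDensity]
  exact ENNReal.one_lt_top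

theorem integral_trajDensity (P : Dynamics O A H ν) (π : Policy O A H) :
    ∫ τ, trajDensity P π τ ∂(refMeasure A H ν) = 1 := by
  rw [integral_eq_lintegral_of_nonneg_ae (Filter.Eventually.of_forall (trajDensity_nonneg P π))
    (measurable_trajDensity P π).aestronglyMeasurable, lintegral_trajDensity, ENNReal.toReal_one]

section Value

variable {R : Fin H → O → ℝ}

theorem measurable_totalReward (hR : ∀ h, Measurable (R h)) :
    Measurable fun τ : Traj O A H => ∑ h : Fin H, R h (τ h).1 :=
  Finset.measurable_fun_sum _ fun h _ => (hR h).comp (measurable_fst.comp (measurable_pi_apply h))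

theorem totalReward_nonneg (hR1 : ∀ h o, 0 ≤ R h o ∧ R h o ≤ 1) (τ : Traj O A H) :
    0 ≤ ∑ h : Fin H, R h (τ h).1 :=
  sum_nonneg fun h _ => (hR1 h _).1

theorem totalReward_le (hR1 : ∀ h o, 0 ≤ R h o ∧ R h o ≤ 1) (τ : Traj O A H) :
    ∑ h : Fin H, R h (τ h).1 ≤ H := by
  calc ∑ h : Fin H, R h (τ h).1 ≤ ∑ _h : Fin H, (1 : ℝ) := sum_le_sum fun h _ => (hR1 h _).2
    _ = H := by simp

theorem abs_totalReward_le (hR1 : ∀ h o, 0 ≤ R h o ∧ R h o ≤ 1) (τ : Traj O A H) :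
    |∑ h : Fin H, R h (τ h).1| ≤ H := by
  rw [abs_of_nonneg (totalReward_nonneg hR1 τ)]
  exact totalReward_le hR1 τ

theorem integrable_totalReward (hR : ∀ h, Measurable (R h))
    (hR1 : ∀ h o, 0 ≤ R h o ∧ R h o ≤ 1) (μ : Measure (Traj O A H)) [IsFiniteMeasure μ] :
    Integrable (fun τ : Traj O A H => ∑ h : Fin H, R h (τ h).1) μ :=
  Integrable.of_bound (measurable_totalReward hR).aestronglyMeasurable H
    (Filter.Eventually.of_forall fun τ => abs_totalReward_le hR1 τ)

theorem value_eq_integral (P : Dynamics O A H ν) (π : Policy O A H) :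
    value R P π =
      ∫ τ, trajDensity P π τ * ∑ h : Fin H, R h (τ h).1 ∂(refMeasure A H ν) := by
  rw [value, rewardOf, trajLaw, integral_withDensity_eq_integral_toReal_smul
    (measurable_trajDensity P π).ennreal_ofReal
    (Filter.Eventually.of_forall fun _ => ENNReal.ofReal_lt_top)]
  simp only [ENNReal.toReal_ofReal (trajDensity_nonneg P π _), smul_eq_mul]

/-- Values of a policy in two systems differ by at most a multiple of the total variation
distance. -/
theorem value_sub_value_le (hR : ∀ h, Measurable (R h)) (hR1 : ∀ h o, 0 ≤ R h o ∧ R h o ≤ 1)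
    (P Q : Dynamics O A H ν) (π : Policy O A H) :
    value R P π - value R Q π ≤ 2 * H * tvDist P Q π := by
  have hi : ∀ P : Dynamics O A H ν, Integrable
      (fun τ => trajDensity P π τ * ∑ h : Fin H, R h (τ h).1) (refMeasure A H ν) := fun P =>
    (integrable_trajDensity P π).mul_bdd (c := H) (measurable_totalReward hR).aestronglyMeasurable
      (Filter.Eventually.of_forall fun τ => abs_totalReward_le hR1 τ)
  rw [value_eq_integral, value_eq_integral, ← integral_sub (hi P) (hi Q), tvDist]
  have hd : Integrable (fun τ => |trajDensity P π τ - trajDensity Q π τ|) (refMeasure A H ν) :=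
    ((integrable_trajDensity P π).sub (integrable_trajDensity Q π)).abs
  calc _ ≤ ∫ τ, H * |trajDensity P π τ - trajDensity Q π τ| ∂(refMeasure A H ν) := by
        refine integral_mono ((hi P).sub (hi Q)) (hd.const_mul _) fun τ => ?_
        simp only
        rw [← sub_mul, mul_comm]
        calc _ ≤ (∑ h : Fin H, R h (τ h).1) * |trajDensity P π τ - trajDensity Q π τ| :=
              mul_le_mul_of_nonneg_left (le_abs_self _) (totalReward_nonneg hR1 τ)
          _ ≤ _ := mul_le_mul_of_nonneg_right (totalReward_le hR1 τ) (abs_nonneg _)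
    _ = _ := by
        rw [integral_const_mul]
        ring

end Value

end

/-! ### Hellinger affinity of a bracket with the true system -/

section

open Finset

variable {O A : Type*} [MeasurableSpace O] [MeasurableSpace A] [Fintype A] {H : ℕ}
  {ν : Measure O} [MeasurableSingletonClass A] [SigmaFinite ν]

/-- The square root of the likelihood ratio of `v` and `Q` (zero where `Q` vanishes). The policy
cancels in this ratio. -/
def sqrtRatio (Q : Dynamics O A H ν) (v : Traj O A H → ℝ) (τ : Traj O A H) : ENNReal :=
  ENNReal.ofReal (Real.sqrt (v τ / Q.obsDensity τ))

/-- The expectation of `sqrtRatio` when `π` is run in `Q`, that is, the Hellinger affinity of the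
densities `v * π.weight` and `trajDensity Q π`. -/
def affinity (Q : Dynamics O A H ν) (v : Traj O A H → ℝ) (π : Policy O A H) : ENNReal :=
  ∫⁻ τ, sqrtRatio Q v τ ∂(trajLaw Q π)

theorem measurable_sqrtRatio (Q : Dynamics O A H ν) {v : Traj O A H → ℝ} (hv : Measurable v) :
    Measurable (sqrtRatio Q v) :=
  (hv.div Q.measurable_obsDensity).sqrt.ennreal_ofReal

theorem affinity_eq (Q : Dynamics O A H ν) {v : Traj O A H → ℝ} (hv : Measurable v)
    (hv0 : ∀ τ, 0 ≤ v τ) (π : Policy O A H) :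
    affinity Q v π = ∫⁻ τ, ENNReal.ofReal
      (Real.sqrt (v τ * π.weight τ) * Real.sqrt (trajDensity Q π τ)) ∂(refMeasure A H ν) := by
  rw [affinity, trajLaw, lintegral_withDensity_eq_lintegral_mul _
    (measurable_trajDensity Q π).ennreal_ofReal (measurable_sqrtRatio Q hv)]
  refine lintegral_congr fun τ => ?_
  have hw := π.weight_nonneg τ
  have hq := Q.obsDensity_nonneg τ
  rw [Pi.mul_apply, sqrtRatio, ← ENNReal.ofReal_mul (trajDensity_nonneg Q π τ), trajDensity,
    Real.sqrt_mul (hv0 τ), Real.sqrt_mul hq, Real.sqrt_div (hv0 τ)]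
  congr 1
  rcases hq.eq_or_lt with h | h
  · simp [← h]
  · have h1 : Real.sqrt (Q.obsDensity τ) ≠ 0 := (Real.sqrt_pos.2 h).ne'
    nth_rewrite 1 [← Real.mul_self_sqrt hq, ← Real.mul_self_sqrt hw]
    field_simp

/-- The affinity of an upper bracket of `P` with the true density is bounded away from `1` by the
squared total variation distance of `P` to the truth, up to the width of the bracket. -/
theorem affinity_le_exp (P Q : Dynamics O A H ν) (π : Policy O A H) {l v : Traj O A H → ℝ}
    (hv : Measurable v) (hl : ∀ τ, l τ ≤ P.obsDensity τ) (hPv : ∀ τ, P.obsDensity τ ≤ v τ)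
    {ε : ℝ} (hε : 0 ≤ ε) (hε1 : ε ≤ 1) (hd : policyDist ν l v < ENNReal.ofReal ε) :
    affinity Q v π ≤ ENNReal.ofReal (Real.exp (ε - tvDist P Q π ^ 2 / 6)) := by
  set μ := refMeasure A H ν
  have hv0 : ∀ τ, 0 ≤ v τ := fun τ => (P.obsDensity_nonneg τ).trans (hPv τ)
  set p := trajDensity P π with hp
  set q := trajDensity Q π with hq
  set U : Traj O A H → ℝ := fun τ => v τ * π.weight τ with hU
  have hU0 : ∀ τ, 0 ≤ U τ := fun τ => mul_nonneg (hv0 τ) (π.weight_nonneg τ)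
  have hq0 : ∀ τ, 0 ≤ q τ := trajDensity_nonneg Q π
  have hpi : Integrable p μ := integrable_trajDensity P π
  have hqi : Integrable q μ := integrable_trajDensity Q π
  have hUm : Measurable U := hv.mul π.measurable_weight
  have hpm : Measurable p := measurable_trajDensity P π
  have hqm : Measurable q := measurable_trajDensity Q π
  have hpU : ∀ τ, p τ ≤ U τ := fun τ => mul_le_mul_of_nonneg_right (hPv τ) (π.weight_nonneg τ)
  -- The bracket is within `ε` of the density of `P`.
  have hlint : ∫⁻ τ, ENNReal.ofReal (U τ - p τ) ∂μ ≤ ENNReal.ofReal ε := by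
    refine le_trans (le_trans (lintegral_mono fun τ => ENNReal.ofReal_le_ofReal ?_)
      (le_iSup (fun π : Policy O A H =>
        ∫⁻ τ, ENNReal.ofReal (|l τ - v τ| * π.weight τ) ∂μ) π)) hd.le
    rw [hU, hp, trajDensity, ← sub_mul]
    refine mul_le_mul_of_nonneg_right ?_ (π.weight_nonneg τ)
    rw [abs_sub_comm]
    exact le_trans (by linarith [hl τ]) (le_abs_self _)
  have hDi : Integrable (fun τ => U τ - p τ) μ := by
    refine ⟨(hUm.sub hpm).aestronglyMeasurable, ?_⟩
    rw [hasFiniteIntegral_iff_ofReal (Filter.Eventually.of_forall fun τ => sub_nonneg.2 (hpU τ))]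
    exact hlint.trans_lt ENNReal.ofReal_lt_top
  have hDle : ∫ τ, (U τ - p τ) ∂μ ≤ ε := by
    rw [integral_eq_lintegral_of_nonneg_ae
      (Filter.Eventually.of_forall fun τ => sub_nonneg.2 (hpU τ))
      (hUm.sub hpm).aestronglyMeasurable]
    exact ENNReal.toReal_le_of_le_ofReal hε hlint
  have hUi : Integrable U μ := by
    have e : U = (fun τ => U τ - p τ) + p := by
      funext τ
      simp
    rw [e]
    exact hDi.add hpi
  have hUle : ∫ τ, U τ ∂μ ≤ 1 + ε := by
    rw [integral_sub hUi hpi, hp, integral_trajDensity] at hDle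
    linarith
  set s : Traj O A H → ℝ := fun τ => Real.sqrt (U τ) * Real.sqrt (q τ) with hs
  have hsm : Measurable s := hUm.sqrt.mul hqm.sqrt
  have hs0 : ∀ τ, 0 ≤ s τ := fun τ => mul_nonneg (Real.sqrt_nonneg _) (Real.sqrt_nonneg _)
  have hsle : ∀ τ, s τ ≤ (U τ + q τ) / 2 := fun τ => by
    have := two_mul_le_add_sq (Real.sqrt (U τ)) (Real.sqrt (q τ))
    rw [Real.sq_sqrt (hU0 τ), Real.sq_sqrt (hq0 τ)] at this
    simp only [hs]
    linarith
  have hsi : Integrable s μ :=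
    ((hUi.add hqi).div_const 2).mono' hsm.aestronglyMeasurable
      (Filter.Eventually.of_forall fun τ => by
        rw [Real.norm_of_nonneg (hs0 τ)]
        exact hsle τ)
  set a := ∫ τ, s τ ∂μ with ha
  have haff : affinity Q v π = ENNReal.ofReal a := by
    rw [affinity_eq Q hv hv0, ha,
      ofReal_integral_eq_lintegral_ofReal hsi (Filter.Eventually.of_forall hs0)]
  have hqint : ∫ τ, q τ ∂μ = 1 := integral_trajDensity Q π
  have haU : 2 * a ≤ ∫ τ, U τ ∂μ + 1 := by
    have h1 : a ≤ ∫ τ, (U τ + q τ) / 2 ∂μ :=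
      integral_mono hsi ((hUi.add hqi).div_const 2) hsle
    rw [integral_div, integral_add hUi hqi, hqint] at h1
    linarith
  set X := ∫ τ, |U τ - q τ| ∂μ with hX
  have hXi : Integrable (fun τ => |U τ - q τ|) μ := (hUi.sub hqi).abs
  have hX0 : 0 ≤ X := integral_nonneg fun _ => abs_nonneg _
  set h := (∫ τ, U τ ∂μ + 1) / 2 - a with hh
  have hh0 : 0 ≤ h := by linarith
  -- Cauchy–Schwarz for `|U - q| = |√U - √q| (√U + √q)`, in the form of a weighted AM-GM.
  have hXh : X ^ 2 ≤ 12 * h := by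
    rcases hX0.eq_or_lt with h0 | hXpos
    · rw [← h0]
      nlinarith
    -- With this weight the bound `X ≤ c * h + 3 / c` has half of `X` as its second term.
    set c := 6 / X with hc
    have hc0 : 0 < c := by positivity
    have hpt : ∀ τ, |U τ - q τ| ≤ c / 2 * (U τ + q τ - 2 * s τ) + 1 / (2 * c) * (2 * (U τ + q τ)) := by
      intro τ
      have e1 : U τ + q τ - 2 * s τ = (Real.sqrt (U τ) - Real.sqrt (q τ)) ^ 2 := by
        rw [sub_sq, Real.sq_sqrt (hU0 τ), Real.sq_sqrt (hq0 τ)]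
        simp only [hs]
        ring
      have e2 : (Real.sqrt (U τ) + Real.sqrt (q τ)) ^ 2 ≤ 2 * (U τ + q τ) := by
        rw [add_sq, Real.sq_sqrt (hU0 τ), Real.sq_sqrt (hq0 τ)]
        have := hsle τ
        simp only [hs] at this
        linarith
      have e3 : |U τ - q τ| =
          |Real.sqrt (U τ) - Real.sqrt (q τ)| * (Real.sqrt (U τ) + Real.sqrt (q τ)) := by
        rw [← abs_of_nonneg (add_nonneg (Real.sqrt_nonneg (U τ)) (Real.sqrt_nonneg (q τ))),
          ← abs_mul, mul_comm, ← sq_sub_sq, Real.sq_sqrt (hU0 τ), Real.sq_sqrt (hq0 τ)]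
      have e4 : 1 / (2 * c) * (Real.sqrt (U τ) + Real.sqrt (q τ)) ^ 2 ≤
          1 / (2 * c) * (2 * (U τ + q τ)) := by gcongr
      rw [e1, e3]
      refine le_trans ?_ (add_le_add_right e4 _)
      rw [← sq_abs (Real.sqrt (U τ) - Real.sqrt (q τ))]
      set α := |Real.sqrt (U τ) - Real.sqrt (q τ)|
      set b := Real.sqrt (U τ) + Real.sqrt (q τ)
      have e5 : c / 2 * α ^ 2 + 1 / (2 * c) * b ^ 2 - α * b = (c * α - b) ^ 2 / (2 * c) := by
        field_simp
        ring
      have e6 : 0 ≤ (c * α - b) ^ 2 / (2 * c) := by positivity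
      linarith
    have hi1 : Integrable (fun τ => c / 2 * (U τ + q τ - 2 * s τ)) μ :=
      ((hUi.add hqi).sub (hsi.const_mul 2)).const_mul _
    have hi2 : Integrable (fun τ => 1 / (2 * c) * (2 * (U τ + q τ))) μ :=
      ((hUi.add hqi).const_mul 2).const_mul _
    have h1 : X ≤ _ := integral_mono hXi (hi1.add hi2) hpt
    have h2 : ∫ τ, (U τ + q τ - 2 * s τ) ∂μ = 2 * h := by
      have : ∫ τ, (U τ + q τ - 2 * s τ) ∂μ = ∫ τ, (U τ + q τ) ∂μ - ∫ τ, 2 * s τ ∂μ :=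
        integral_sub (hUi.add hqi) (hsi.const_mul 2)
      rw [this, integral_add hUi hqi, integral_const_mul, hqint]
      rw [hh]
      ring
    have h3 : ∫ τ, (U τ + q τ) ∂μ ≤ 3 := by
      rw [integral_add hUi hqi, hqint]
      linarith
    have h4 : X ≤ c * h + 3 / c := by
      rw [Pi.add_def, integral_add hi1 hi2, integral_const_mul, integral_const_mul,
        integral_const_mul, h2] at h1
      have h5 : 1 / (2 * c) * (2 * ∫ τ, (U τ + q τ) ∂μ) ≤ 1 / (2 * c) * (2 * 3) := by gcongr
      have h6 : 1 / (2 * c) * (2 * 3) = 3 / c := by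
        field_simp
      linarith
    have h7 : c * X = 6 := by rw [hc]; field_simp
    have h8 : 3 / c = X / 2 := by
      rw [div_eq_iff hc0.ne']
      linarith
    rw [h8] at h4
    have h9 : X / 2 * X ≤ c * h * X := mul_le_mul_of_nonneg_right (by linarith) hX0
    nlinarith
  have htv : tvDist P Q π ≤ (ε + X) / 2 := by
    have h1 : ∫ τ, |p τ - q τ| ∂μ ≤ ∫ τ, ((U τ - p τ) + |U τ - q τ|) ∂μ := by
      refine integral_mono ((hpi.sub hqi).abs) (hDi.add hXi) fun τ => ?_
      have := abs_sub_le (p τ) (U τ) (q τ)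
      rw [abs_sub_comm (p τ) (U τ), abs_of_nonneg (sub_nonneg.2 (hpU τ))] at this
      exact this
    rw [integral_add hDi hXi] at h1
    rw [tvDist]
    linarith
  have htv2 : tvDist P Q π ^ 2 ≤ ε ^ 2 / 2 + 6 * h := by
    have h1 := pow_le_pow_left₀ (tvDist_nonneg P Q π) htv 2
    nlinarith [sq_nonneg (ε - X)]
  rw [haff]
  refine ENNReal.ofReal_le_ofReal (le_trans ?_ (Real.add_one_le_exp _))
  nlinarith

end

/-! ### Conditional independence and conditional densities -/

section

open Finset

/-- Independence given the past for products of functions. The functions are substituted for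
indicators one at a time, each time by comparing two measures on `T`. -/
theorem setLIntegral_prod_eq {Ω T : Type*} [MeasurableSpace Ω] [MeasurableSpace T]
    (μ : Measure Ω) {X : ℕ → Ω → T} {ρ : ℕ → Ω → Measure T} {n : ℕ}
    (hX : ∀ j < n, Measurable (X j)) (hρ : ∀ j, Measurable (ρ j))
    (hμ : ∀ S : ℕ → Set T, (∀ j, MeasurableSet (S j)) →
      μ {ω | ∀ j < n, X j ω ∈ S j} = ∫⁻ ω, ∏ j ∈ range n, ρ j ω (S j) ∂μ)
    {φ : ℕ → T → ENNReal} (hφ : ∀ j, Measurable (φ j)) :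
    ∫⁻ ω, ∏ j ∈ range n, φ j (X j ω) ∂μ =
      ∫⁻ ω, ∏ j ∈ range n, ∫⁻ t, φ j t ∂(ρ j ω) ∂μ := by
  have hcongr : ∀ φ φ' : ℕ → T → ENNReal, (∀ j ∈ range n, φ j = φ' j) →
      ∫⁻ ω, ∏ j ∈ range n, φ j (X j ω) ∂μ =
        ∫⁻ ω, ∏ j ∈ range n, ∫⁻ t, φ j t ∂(ρ j ω) ∂μ →
      ∫⁻ ω, ∏ j ∈ range n, φ' j (X j ω) ∂μ =
        ∫⁻ ω, ∏ j ∈ range n, ∫⁻ t, φ' j t ∂(ρ j ω) ∂μ := by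
    intro φ φ' he h
    have e1 : ∀ ω, ∏ j ∈ range n, φ j (X j ω) = ∏ j ∈ range n, φ' j (X j ω) :=
      fun ω => prod_congr rfl fun j hj => by rw [he j hj]
    have e2 : ∀ ω, ∏ j ∈ range n, ∫⁻ t, φ j t ∂(ρ j ω) = ∏ j ∈ range n, ∫⁻ t, φ' j t ∂(ρ j ω) :=
      fun ω => prod_congr rfl fun j hj => by rw [he j hj]
    simpa only [e1, e2] using h
  suffices h : ∀ (J : Finset ℕ) (φ : ℕ → T → ENNReal), (∀ j, Measurable (φ j)) →
      (∀ j ∉ J, ∃ S, MeasurableSet S ∧ φ j = S.indicator 1) →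
      ∫⁻ ω, ∏ j ∈ range n, φ j (X j ω) ∂μ =
        ∫⁻ ω, ∏ j ∈ range n, ∫⁻ t, φ j t ∂(ρ j ω) ∂μ by
    have h' := h (range n) (fun j => if j < n then φ j else Set.univ.indicator 1)
      (fun j => by
        by_cases hj : j < n
        · simpa [hj] using hφ j
        · simpa [hj] using measurable_one)
      (fun j hj => ⟨Set.univ, MeasurableSet.univ, by rw [mem_range] at hj; rw [if_neg hj]⟩)
    exact hcongr _ φ (fun j hj => if_pos (mem_range.1 hj)) h'
  intro J
  induction J using Finset.induction_on with
  | empty =>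
    intro φ _ hind
    choose S hS hφS using fun j => hind j (notMem_empty j)
    have hm : MeasurableSet {ω | ∀ j < n, X j ω ∈ S j} := by
      have : {ω | ∀ j < n, X j ω ∈ S j} = ⋂ j ∈ range n, X j ⁻¹' S j := by
        ext ω
        simp
      rw [this]
      exact Finset.measurableSet_biInter _ fun j hj => hX j (mem_range.1 hj) (hS j)
    have e1 : ∀ ω, ∏ j ∈ range n, φ j (X j ω) =
        {ω | ∀ j < n, X j ω ∈ S j}.indicator 1 ω := by
      intro ω
      simp only [hφS]
      by_cases hω : ∀ j < n, X j ω ∈ S j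
      · rw [Set.indicator_of_mem (by exact hω)]
        exact prod_eq_one fun j hj => Set.indicator_of_mem (hω j (mem_range.1 hj)) _
      · rw [Set.indicator_of_notMem (by exact hω)]
        push Not at hω
        obtain ⟨j, hj, hjS⟩ := hω
        exact prod_eq_zero (mem_range.2 hj) (Set.indicator_of_notMem hjS _)
    simp only [e1]
    rw [lintegral_indicator_one hm, hμ S hS]
    refine lintegral_congr fun ω => prod_congr rfl fun j _ => ?_
    rw [hφS, lintegral_indicator_one (hS j)]
  | insert r J _ ih =>
    intro φ hφ hind
    have hupd : ∀ S, MeasurableSet S →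
        ∫⁻ ω, ∏ j ∈ range n, Function.update φ r (S.indicator 1) j (X j ω) ∂μ =
          ∫⁻ ω, ∏ j ∈ range n, ∫⁻ t, Function.update φ r (S.indicator 1) j t ∂(ρ j ω) ∂μ := by
      intro S hS
      refine ih _ (fun j => ?_) fun j hj => ?_
      · rcases eq_or_ne j r with rfl | hjr
        · simpa using measurable_one.indicator hS
        · simpa [hjr] using hφ j
      · rcases eq_or_ne j r with rfl | hjr
        · exact ⟨S, hS, by simp⟩
        · obtain ⟨S', h1, h2⟩ := hind j (by simp [hjr, hj])
          exact ⟨S', h1, by simpa [hjr] using h2⟩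
    by_cases hr : r ∈ range n
    · have hXr := hX r (mem_range.1 hr)
      set G : Ω → ENNReal := fun ω => ∏ j ∈ (range n).erase r, φ j (X j ω) with hG
      set G' : Ω → ENNReal := fun ω => ∏ j ∈ (range n).erase r, ∫⁻ t, φ j t ∂(ρ j ω) with hG'
      have hGm : Measurable G := Finset.measurable_fun_prod _ fun j hj =>
        (hφ j).comp (hX j (mem_range.1 (mem_of_mem_erase hj)))
      have hG'm : Measurable G' := Finset.measurable_fun_prod _ fun j _ =>
        (Measure.measurable_lintegral (hφ j)).comp (hρ j)
      have hmeas : (μ.withDensity G).map (X r) = (μ.withDensity G').bind (ρ r) := by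
        ext S hS
        have hρS : Measurable fun ω => ρ r ω S := (Measure.measurable_coe hS).comp (hρ r)
        have h1 := hupd S hS
        rw [lintegral_congr fun ω => (mul_prod_erase (range n) _ hr).symm,
          lintegral_congr fun ω => (mul_prod_erase (range n) (fun j =>
            ∫⁻ t, Function.update φ r (S.indicator 1) j t ∂(ρ j ω)) hr).symm] at h1
        have e1 : ∀ ω, ∏ j ∈ (range n).erase r, Function.update φ r (S.indicator 1) j (X j ω) =
            G ω := fun ω => prod_congr rfl fun j hj => by
          rw [Function.update_of_ne (ne_of_mem_erase hj)]
        have e2 : ∀ ω, ∏ j ∈ (range n).erase r,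
            ∫⁻ t, Function.update φ r (S.indicator 1) j t ∂(ρ j ω) = G' ω :=
          fun ω => prod_congr rfl fun j hj => by
            rw [Function.update_of_ne (ne_of_mem_erase hj)]
        simp only [e1, e2, Function.update_self] at h1
        rw [Measure.map_apply hXr hS, Measure.bind_apply hS (hρ r).aemeasurable,
          withDensity_apply _ (hXr hS), lintegral_withDensity_eq_lintegral_mul _ hG'm hρS, ← lintegral_indicator (hXr hS)]
        refine Eq.trans (lintegral_congr fun ω => ?_) (h1.trans (lintegral_congr fun ω => ?_))
        · by_cases hω : X r ω ∈ S
          · rw [Set.indicator_of_mem (by exact hω), Set.indicator_of_mem hω, Pi.one_apply, one_mul]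
          · rw [Set.indicator_of_notMem (by exact hω), Set.indicator_of_notMem hω, zero_mul]
        · rw [lintegral_indicator_one hS, mul_comm]
          rfl
      have hφX : Measurable fun ω => φ r (X r ω) := (hφ r).comp hXr
      have hφρ : Measurable fun ω => ∫⁻ t, φ r t ∂(ρ r ω) :=
        (Measure.measurable_lintegral (hφ r)).comp (hρ r)
      calc ∫⁻ ω, ∏ j ∈ range n, φ j (X j ω) ∂μ = ∫⁻ ω, (G * fun ω => φ r (X r ω)) ω ∂μ :=
            lintegral_congr fun ω => (prod_erase_mul (range n) _ hr).symm
        _ = ∫⁻ t, φ r t ∂((μ.withDensity G).map (X r)) := by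
            rw [lintegral_map (hφ r) hXr,
              lintegral_withDensity_eq_lintegral_mul _ hGm hφX]
        _ = ∫⁻ ω, (G' * fun ω => ∫⁻ t, φ r t ∂(ρ r ω)) ω ∂μ := by
            rw [hmeas, Measure.lintegral_bind (hρ r).aemeasurable (hφ r).aemeasurable,
              lintegral_withDensity_eq_lintegral_mul _ hG'm hφρ]
        _ = _ := lintegral_congr fun ω => prod_erase_mul (range n) _ hr
    · refine hcongr _ φ (fun j hj => Function.update_of_ne ?_ _ _) (hupd Set.univ MeasurableSet.univ)
      rintro rfl
      exact hr hj

/-- Functions with the same integrals over all events of a sub-σ-algebra have the same integral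
against every factor that is measurable with respect to it. -/
theorem lintegral_mul_eq_of_setLIntegral_eq {Ω : Type*} {m mΩ : MeasurableSpace Ω} (hm : m ≤ mΩ)
    (μ : Measure Ω) {F₁ F₂ Z : Ω → ENNReal} (hF₁ : Measurable F₁) (hF₂ : Measurable F₂)
    (h : ∀ E, MeasurableSet[m] E → ∫⁻ ω in E, F₁ ω ∂μ = ∫⁻ ω in E, F₂ ω ∂μ)
    (hZ : Measurable[m] Z) : ∫⁻ ω, Z ω * F₁ ω ∂μ = ∫⁻ ω, Z ω * F₂ ω ∂μ := by
  have htrim : (μ.withDensity F₁).trim hm = (μ.withDensity F₂).trim hm := by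
    refine @Measure.ext _ m _ _ fun E hE => ?_
    rw [trim_measurableSet_eq hm hE, trim_measurableSet_eq hm hE, withDensity_apply _ (hm E hE),
      withDensity_apply _ (hm E hE), h E hE]
  have key : ∀ F : Ω → ENNReal, Measurable F →
      ∫⁻ ω, Z ω * F ω ∂μ = ∫⁻ ω, Z ω ∂((μ.withDensity F).trim hm) := by
    intro F hF
    rw [lintegral_trim hm hZ, lintegral_withDensity_eq_lintegral_mul _ hF (hZ.mono hm le_rfl)]
    exact lintegral_congr fun ω => mul_comm _ _
  rw [key F₁ hF₁, key F₂ hF₂, htrim]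

section JointLaw

open ProbabilityTheory

/-- The joint law of the past `ι` and of an observation `X` whose conditional law is `κ`. -/
theorem map_prodMk_eq_compProd {Ω Ω' T : Type*} [MeasurableSpace Ω] [MeasurableSpace Ω']
    [MeasurableSpace T] (μ : Measure Ω) [IsFiniteMeasure μ] {ι : Ω → Ω'} (hι : Measurable ι)
    {X : Ω → T} (hX : Measurable X) (κ : Kernel Ω' T) [IsSFiniteKernel κ]
    (h : ∀ (E : Set Ω') (S : Set T), MeasurableSet E → MeasurableSet S →
      μ (ι ⁻¹' E ∩ X ⁻¹' S) = ∫⁻ ω in ι ⁻¹' E, κ (ι ω) S ∂μ) :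
    μ.map (fun ω => (ι ω, X ω)) = (μ.map ι) ⊗ₘ κ := by
  refine Measure.ext_prod fun {E S} hE hS => ?_
  rw [Measure.map_apply (hι.prodMk hX) (hE.prod hS), Measure.compProd_apply_prod hE hS,
    setLIntegral_map hE (κ.measurable_coe hS) hι, ← h E S hE hS]
  rfl

/-- An observation whose conditional law has a density almost surely avoids the zeros of the
density, also when the density depends on the past. -/
theorem ae_density_ne_zero {Ω Ω' T : Type*} {mΩ : MeasurableSpace Ω} {mΩ' : MeasurableSpace Ω'}
    [MeasurableSpace T] (μ : Measure Ω) [IsFiniteMeasure μ] {ι : Ω → Ω'} (hι : Measurable ι)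
    {X : Ω → T} (hX : Measurable X) (ref : Measure T) [SFinite ref] {f : Ω' → T → ENNReal}
    (hf : Measurable (Function.uncurry f)) (hft : ∀ a t, f a t ≠ ⊤)
    (h : ∀ (E : Set Ω') (S : Set T), MeasurableSet E → MeasurableSet S →
      μ (ι ⁻¹' E ∩ X ⁻¹' S) = ∫⁻ ω in ι ⁻¹' E, ref.withDensity (f (ι ω)) S ∂μ) :
    ∀ᵐ ω ∂μ, f (ι ω) (X ω) ≠ 0 := by
  set κ : Kernel Ω' T := Kernel.withDensity (Kernel.const Ω' ref) f with hκ
  have : IsSFiniteKernel κ := Kernel.IsSFiniteKernel.withDensity _ hft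
  have hκa : ∀ a, κ a = ref.withDensity (f a) := fun a => by
    rw [hκ, Kernel.withDensity_apply _ hf, Kernel.const_apply]
  have hjoint := map_prodMk_eq_compProd μ hι hX κ fun E S hE hS => by
    simp only [hκa]
    exact h E S hE hS
  have hD : MeasurableSet {z : Ω' × T | f z.1 z.2 = 0} := hf (measurableSet_singleton 0)
  have h0 : (μ.map fun ω => (ι ω, X ω)) {z : Ω' × T | f z.1 z.2 = 0} = 0 := by
    rw [hjoint, Measure.compProd_apply hD]
    refine (lintegral_eq_zero_iff (Kernel.measurable_kernel_prodMk_left hD)).2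
      (Filter.Eventually.of_forall fun a => ?_)
    simp only [Pi.zero_apply]
    rw [hκa]
    have hfa : Measurable (f a) := hf.of_uncurry_left
    have hS : MeasurableSet (Prod.mk a ⁻¹' {z : Ω' × T | f z.1 z.2 = 0}) :=
      measurable_prodMk_left hD
    rw [withDensity_apply _ hS, setLIntegral_congr_fun (g := fun _ => 0) hS fun t ht => ht]
    simp
  rw [Measure.map_apply (hι.prodMk hX) hD] at h0
  rw [ae_iff]
  simpa using h0

end JointLaw

theorem measurable_prod_range_random {Ω : Type*} {mΩ : MeasurableSpace Ω} {len : Ω → ℕ}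
    (hlen : Measurable len) {g : ℕ → Ω → ENNReal} (hg : ∀ j, Measurable (g j)) :
    Measurable fun ω => ∏ j ∈ range (len ω), g j ω := by
  have : Measurable fun z : ℕ × Ω => ∏ j ∈ range z.1, g j z.2 :=
    measurable_from_prod_countable_right fun n =>
      Finset.measurable_fun_prod (range n) fun j _ => hg j
  exact this.comp (hlen.prodMk measurable_id)

theorem lintegral_eq_tsum_fiber {Ω : Type*} [MeasurableSpace Ω] (μ : Measure Ω) {len : Ω → ℕ}
    (hlen : Measurable len) (f : Ω → ENNReal) :
    ∫⁻ ω, f ω ∂μ = ∑' n, ∫⁻ ω in len ⁻¹' {n}, f ω ∂μ := by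
  have hU : ⋃ n, len ⁻¹' {n} = Set.univ := by
    ext ω
    simp
  rw [← setLIntegral_univ, ← hU]
  refine lintegral_iUnion (fun n => hlen (measurableSet_singleton n)) ?_ f
  intro a b hab
  exact Disjoint.preimage _ (by simpa using hab)

end

/-! ### Adaptive sampling and the likelihood-ratio process -/

section

open Finset

section Adaptive

variable {O A : Type*} [MeasurableSpace O] [MeasurableSpace A] [Fintype A] {H : ℕ}
  {ν : Measure O}
  {Ω : Type*} [mΩ : MeasurableSpace Ω]

/-- Adaptive sampling from the system `Q`: in episode `k < K` the policies of the list `e k`, which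
depends on the past, are executed once each, with the trajectories `τ k 0, τ k 1, …`. -/
structure IsAdaptiveSample (Q : Dynamics O A H ν) (e : ℕ → Ω → List (Policy O A H)) (K : ℕ)
    (ℙ : Measure Ω) (ℱ : Filtration ℕ mΩ) (τ : ℕ → ℕ → Ω → Traj O A H) : Prop where
  data_adapted : ∀ k < K, ∀ j, Measurable[ℱ (k + 1)] (τ k j)
  length_adapted : ∀ k < K, Measurable[ℱ k] fun ω => (e k ω).length
  policy_adapted : ∀ k < K, ∀ j : ℕ,
    Measurable[MeasurableSpace.prod (ℱ k) (inferInstance : MeasurableSpace (Traj O A H))]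
      fun z : Ω × Traj O A H => ((e k z.1)[j]?).elim (0 : ℝ) fun π => π.weight z.2
  sampling : ∀ k < K, ∀ E : Set Ω, MeasurableSet[ℱ k] E →
    ∀ S : ℕ → Set (Traj O A H), (∀ j, MeasurableSet (S j)) →
      ℙ (E ∩ {ω | ∀ j < (e k ω).length, τ k j ω ∈ S j}) =
        ∫⁻ ω in E, ∏ j : Fin (e k ω).length, trajLaw Q ((e k ω).get j) (S j) ∂ℙ

/-- The density of the `j`-th trajectory of an episode with the list `l` of policies, zero if the
list is too short. -/
def listDensity (Q : Dynamics O A H ν) (l : List (Policy O A H)) (j : ℕ) (τ : Traj O A H) : ℝ :=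
  Q.obsDensity τ * (l[j]?).elim 0 fun π => π.weight τ

/-- The law of the `j`-th trajectory of an episode with the list `l` of policies, the zero measure
if the list is too short. -/
def listLaw (Q : Dynamics O A H ν) (l : List (Policy O A H)) (j : ℕ) : Measure (Traj O A H) :=
  (refMeasure A H ν).withDensity fun τ => ENNReal.ofReal (listDensity Q l j τ)

theorem listDensity_eq (Q : Dynamics O A H ν) {l : List (Policy O A H)} {j : ℕ}
    (hj : j < l.length) (τ : Traj O A H) : listDensity Q l j τ = trajDensity Q l[j] τ := by
  simp [listDensity, trajDensity, hj]

theorem listLaw_eq (Q : Dynamics O A H ν) {l : List (Policy O A H)} {j : ℕ}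
    (hj : j < l.length) : listLaw Q l j = trajLaw Q l[j] := by
  simp only [listLaw, trajLaw, listDensity_eq Q hj]

/-- The likelihood-ratio process of the upper bracket `v`, in square-root form and normalized by
the conditional expectations of its factors. -/
def ratioProcess (Q : Dynamics O A H ν) (v : Traj O A H → ℝ) (e : ℕ → Ω → List (Policy O A H))
    (τ : ℕ → ℕ → Ω → Traj O A H) (k : ℕ) (ω : Ω) : ENNReal :=
  ∏ t ∈ range k, ∏ j ∈ range (e t ω).length,
    sqrtRatio Q v (τ t j ω) * (∫⁻ x, sqrtRatio Q v x ∂(listLaw Q (e t ω) j))⁻¹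

variable [MeasurableSingletonClass A] [SigmaFinite ν]
  {Q : Dynamics O A H ν} {e : ℕ → Ω → List (Policy O A H)} {K : ℕ}
  {ℙ : Measure Ω} {ℱ : Filtration ℕ mΩ} {τ : ℕ → ℕ → Ω → Traj O A H}

namespace IsAdaptiveSample

theorem measurable_density (hs : IsAdaptiveSample Q e K ℙ ℱ τ) {k : ℕ} (hk : k < K) (j : ℕ) :
    Measurable[MeasurableSpace.prod (ℱ k) (inferInstance : MeasurableSpace (Traj O A H))]
      fun z : Ω × Traj O A H => ENNReal.ofReal (listDensity Q (e k z.1) j z.2) := by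
  refine Measurable.ennreal_ofReal ?_
  exact (Q.measurable_obsDensity.comp (@measurable_snd _ _ (ℱ k) _)).mul (hs.policy_adapted k hk j)

theorem measurable_lintegral_listLaw (hs : IsAdaptiveSample Q e K ℙ ℱ τ) {k : ℕ} (hk : k < K)
    (j : ℕ) {φ : Traj O A H → ENNReal} (hφ : Measurable φ) :
    Measurable[ℱ k] fun ω => ∫⁻ x, φ x ∂(listLaw Q (e k ω) j) := by
  have hd := hs.measurable_density hk j
  have h1 : ∀ ω, ∫⁻ x, φ x ∂(listLaw Q (e k ω) j) =
      ∫⁻ x, ENNReal.ofReal (listDensity Q (e k ω) j x) * φ x ∂(refMeasure A H ν) := by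
    intro ω
    have hω : Measurable fun x => ENNReal.ofReal (listDensity Q (e k ω) j x) :=
      hd.comp (@measurable_prodMk_left _ _ (ℱ k) _ ω)
    rw [listLaw, lintegral_withDensity_eq_lintegral_mul _ hω hφ]
    rfl
  simp only [h1]
  have h2 : Measurable[MeasurableSpace.prod (ℱ k) (inferInstance : MeasurableSpace (Traj O A H))]
      fun z : Ω × Traj O A H => ENNReal.ofReal (listDensity Q (e k z.1) j z.2) * φ z.2 :=
    hd.mul (hφ.comp (@measurable_snd _ _ (ℱ k) _))
  exact @Measurable.lintegral_prod_right' _ _ (ℱ k) _ _ _ _ h2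

theorem measurable_listLaw (hs : IsAdaptiveSample Q e K ℙ ℱ τ) {k : ℕ} (hk : k < K) (j : ℕ) :
    Measurable[ℱ k] fun ω => listLaw Q (e k ω) j := by
  refine @Measure.measurable_of_measurable_coe _ _ _ (ℱ k) _ fun S hS => ?_
  have := hs.measurable_lintegral_listLaw hk j (φ := S.indicator 1) (measurable_one.indicator hS)
  simpa only [lintegral_indicator_one hS] using this

theorem measurable_data (hs : IsAdaptiveSample Q e K ℙ ℱ τ) {k : ℕ} (hk : k < K) (j : ℕ) :
    Measurable (τ k j) :=
  (hs.data_adapted k hk j).mono (ℱ.le _) le_rfl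

theorem measurable_length (hs : IsAdaptiveSample Q e K ℙ ℱ τ) {k : ℕ} (hk : k < K) :
    Measurable fun ω => (e k ω).length :=
  (hs.length_adapted k hk).mono (ℱ.le _) le_rfl

theorem sampling_range (hs : IsAdaptiveSample Q e K ℙ ℱ τ) {k : ℕ} (hk : k < K) {E : Set Ω}
    (hE : MeasurableSet[ℱ k] E) {S : ℕ → Set (Traj O A H)} (hS : ∀ j, MeasurableSet (S j)) :
    ℙ (E ∩ {ω | ∀ j < (e k ω).length, τ k j ω ∈ S j}) =
      ∫⁻ ω in E, ∏ j ∈ range (e k ω).length, listLaw Q (e k ω) j (S j) ∂ℙ := by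
  rw [hs.sampling k hk E hE S hS]
  refine lintegral_congr fun ω => ?_
  rw [prod_range]
  refine prod_congr rfl fun j _ => ?_
  rw [listLaw_eq Q j.2]
  rfl

/-- Almost surely the collected trajectories have positive density in the true system. -/
theorem ae_trajDensity_pos [IsProbabilityMeasure ℙ] (hs : IsAdaptiveSample Q e K ℙ ℱ τ) :
    ∀ᵐ ω ∂ℙ, ∀ k < K, ∀ j (hj : j < (e k ω).length), 0 < trajDensity Q (e k ω)[j] (τ k j ω) := by
  rw [ae_all_iff]
  intro k
  by_cases hk : k < K
  swap
  · exact Filter.Eventually.of_forall fun ω h => absurd h hk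
  have key : ∀ j, ∀ᵐ ω ∂ℙ, j < (e k ω).length →
      ENNReal.ofReal (listDensity Q (e k ω) j (τ k j ω)) ≠ 0 := by
    intro j
    have hL : MeasurableSet[ℱ k] {ω | j < (e k ω).length} :=
      hs.length_adapted k hk measurableSet_Ioi
    have hL' : MeasurableSet {ω | j < (e k ω).length} := ℱ.le k _ hL
    refine (ae_restrict_iff' hL').1 ?_
    refine ae_density_ne_zero (mΩ' := ℱ k) (ℙ.restrict {ω | j < (e k ω).length}) (ι := id)
      (fun s hs => ℱ.le k s hs) (hs.measurable_data hk j) (refMeasure A H ν)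
      (f := fun ω x => ENNReal.ofReal (listDensity Q (e k ω) j x))
      (hs.measurable_density hk j) (fun _ _ => ENNReal.ofReal_ne_top) fun E S hE hS => ?_
    have h1 := hs.sampling_range hk (hE.inter hL)
      (S := fun i => if i = j then S else Set.univ) (fun i => by
        split_ifs
        · exact hS
        · exact MeasurableSet.univ)
    have hE' : MeasurableSet E := ℱ.le k _ hE
    rw [Set.preimage_id, Measure.restrict_apply (hE'.inter (hs.measurable_data hk j hS)),
      Measure.restrict_restrict hE']
    refine Eq.trans (congrArg ℙ ?_) (h1.trans (setLIntegral_congr_fun (hE'.inter hL') ?_))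
    · ext ω
      constructor
      · rintro ⟨⟨h2, h3⟩, h4⟩
        refine ⟨⟨h2, h4⟩, fun i _ => ?_⟩
        by_cases hi : i = j
        · subst hi
          simpa using h3
        · simp [hi]
      · rintro ⟨⟨h2, h4⟩, h5⟩
        refine ⟨⟨h2, ?_⟩, h4⟩
        simpa using h5 j h4
    · intro ω hω
      have hj : j ∈ range (e k ω).length := mem_range.2 hω.2
      simp only
      rw [prod_eq_single_of_mem j hj]
      · rw [if_pos rfl]
        rfl
      · intro i hi hij
        rw [if_neg hij, listLaw_eq Q (mem_range.1 hi), measure_univ]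
  filter_upwards [ae_all_iff.2 key] with ω hω _ j hj
  have := hω j hj
  rw [listDensity_eq Q hj] at this
  exact (trajDensity_nonneg Q _ _).lt_of_ne fun h => this (by rw [← h, ENNReal.ofReal_zero])

theorem measurable_ratioProcess (hs : IsAdaptiveSample Q e K ℙ ℱ τ) {v : Traj O A H → ℝ}
    (hv : Measurable v) {k : ℕ} (hk : k ≤ K) : Measurable[ℱ k] (ratioProcess Q v e τ k) := by
  refine @Finset.measurable_fun_prod _ _ _ _ _ _ (ℱ k) _ _ fun t ht => ?_
  have htk : t < k := mem_range.1 ht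
  have htK : t < K := htk.trans_le hk
  refine measurable_prod_range_random (mΩ := ℱ k)
    ((hs.length_adapted t htK).mono (ℱ.mono htk.le) le_rfl) fun j => ?_
  exact ((measurable_sqrtRatio Q hv).comp
    ((hs.data_adapted t htK j).mono (ℱ.mono htk) le_rfl)).mul
    ((hs.measurable_lintegral_listLaw htK j (measurable_sqrtRatio Q hv)).mono
      (ℱ.mono htk.le) le_rfl).inv

/-- Given the past, the normalized factors of an episode have a product of mean at most `1`, so the
process is a supermartingale with initial value `1`. -/
theorem lintegral_ratioProcess_le_one [IsProbabilityMeasure ℙ] (hs : IsAdaptiveSample Q e K ℙ ℱ τ)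
    {v : Traj O A H → ℝ} (hv : Measurable v) {k : ℕ} (hk : k ≤ K) :
    ∫⁻ ω, ratioProcess Q v e τ k ω ∂ℙ ≤ 1 := by
  induction k with
  | zero => simp [ratioProcess]
  | succ k ih =>
    refine le_trans ?_ (ih (Nat.le_of_succ_le hk))
    have hkK : k < K := hk
    have hlen := hs.measurable_length hkK
    have hφ := measurable_sqrtRatio Q hv
    set a : ℕ → Ω → ENNReal := fun j ω => ∫⁻ x, sqrtRatio Q v x ∂(listLaw Q (e k ω) j) with ha
    have ham : ∀ j, Measurable[ℱ k] (a j) := fun j => hs.measurable_lintegral_listLaw hkK j hφ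
    have hW := hs.measurable_ratioProcess hv hkK.le
    -- The number of executed policies is random, but constant on each of these events.
    rw [lintegral_eq_tsum_fiber ℙ hlen, lintegral_eq_tsum_fiber ℙ hlen]
    refine ENNReal.tsum_le_tsum fun n => ?_
    set L : Set Ω := (fun ω => (e k ω).length) ⁻¹' {n} with hL
    have hLm : MeasurableSet[ℱ k] L := hs.length_adapted k hkK (measurableSet_singleton n)
    have hLm' : MeasurableSet L := ℱ.le k _ hLm
    set Z : Ω → ENNReal := fun ω => ratioProcess Q v e τ k ω * ∏ j ∈ range n, (a j ω)⁻¹ with hZ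
    have hZm : Measurable[ℱ k] Z :=
      hW.mul (@Finset.measurable_fun_prod _ _ _ _ _ _ (ℱ k) _ _ fun j _ => (ham j).inv)
    set F₁ : Ω → ENNReal := fun ω => ∏ j ∈ range n, sqrtRatio Q v (τ k j ω)
    set F₂ : Ω → ENNReal := fun ω => ∏ j ∈ range n, a j ω
    have hF₁ : Measurable F₁ := Finset.measurable_fun_prod _ fun j _ =>
      hφ.comp (hs.measurable_data hkK j)
    have hF₂ : Measurable F₂ := Finset.measurable_fun_prod _ fun j _ =>
      (ham j).mono (ℱ.le k) le_rfl
    have heq : ∫⁻ ω in L, Z ω * F₁ ω ∂ℙ = ∫⁻ ω in L, Z ω * F₂ ω ∂ℙ := by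
      refine lintegral_mul_eq_of_setLIntegral_eq (ℱ.le k) (ℙ.restrict L) hF₁ hF₂ ?_ hZm
      intro E hE
      rw [Measure.restrict_restrict (ℱ.le k _ hE)]
      refine setLIntegral_prod_eq (ℙ.restrict (E ∩ L)) (fun j _ => hs.measurable_data hkK j)
        (ρ := fun j ω => listLaw Q (e k ω) j)
        (fun j => (hs.measurable_listLaw hkK j).mono (ℱ.le k) le_rfl) ?_ (fun _ => hφ)
      intro S hS
      have h1 := hs.sampling_range hkK (hE.inter hLm) hS
      have hEL : MeasurableSet (E ∩ L) := ℱ.le k _ (hE.inter hLm)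
      rw [Measure.restrict_apply' hEL, Set.inter_comm]
      refine Eq.trans (congrArg ℙ ?_) (h1.trans (setLIntegral_congr_fun hEL ?_))
      · ext ω
        refine and_congr_right fun hω => ?_
        have : (e k ω).length = n := hω.2
        simp only [Set.mem_ofPred_eq, this]
      · intro ω hω
        have : (e k ω).length = n := hω.2
        simp only [this]
    calc ∫⁻ ω in L, ratioProcess Q v e τ (k + 1) ω ∂ℙ = ∫⁻ ω in L, Z ω * F₁ ω ∂ℙ := by
          refine setLIntegral_congr_fun hLm' fun ω hω => ?_
          have hn : (e k ω).length = n := hω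
          simp only [hZ, ha, F₁, ratioProcess, prod_range_succ, hn, prod_mul_distrib]
          ring
      _ = ∫⁻ ω in L, Z ω * F₂ ω ∂ℙ := heq
      _ ≤ ∫⁻ ω in L, ratioProcess Q v e τ k ω ∂ℙ := by
          refine lintegral_mono fun ω => ?_
          simp only [hZ, F₂]
          rw [mul_assoc, ← prod_mul_distrib]
          refine mul_le_of_le_one_right' (prod_le_one' fun j _ => ?_)
          rw [mul_comm]
          exact ENNReal.mul_inv_le_one _

end IsAdaptiveSample

end Adaptive

end

/-! ### Likelihoods and confidence sets -/

section

open Finset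

section Likelihood

variable {O A : Type*} [MeasurableSpace O] [MeasurableSpace A] [Fintype A] {H : ℕ}
  {ν : Measure O}

theorem sum_log_ofReal {ι : Type*} (s : Finset ι) (f : ι → ℝ) (hf : ∀ i ∈ s, 0 ≤ f i) :
    ∑ i ∈ s, ENNReal.log (ENNReal.ofReal (f i)) = ENNReal.log (ENNReal.ofReal (∏ i ∈ s, f i)) := by
  rw [ENNReal.ofReal_prod_of_nonneg hf]
  clear hf
  induction s using Finset.cons_induction with
  | empty => simp
  | cons a s ha ih => rw [sum_cons, prod_cons, ENNReal.log_mul_add, ih]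

/-- The likelihood of the data of the first `k` episodes. -/
def likelihood (e : ℕ → List (Policy O A H)) (x : ℕ → ℕ → Traj O A H) (k : ℕ)
    (P : Dynamics O A H ν) : ℝ :=
  ∏ i ∈ range k, ∏ j : Fin (e i).length, trajDensity P ((e i).get j) (x i j)

theorem logLik_eq_log_likelihood (e : ℕ → List (Policy O A H)) (x : ℕ → ℕ → Traj O A H) (k : ℕ)
    (P : Dynamics O A H ν) :
    logLik e x k P = ENNReal.log (ENNReal.ofReal (likelihood e x k P)) := by
  have h0 : ∀ i, ∀ j ∈ (univ : Finset (Fin (e i).length)),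
      0 ≤ trajDensity P ((e i).get j) (x i j) := fun i j _ => trajDensity_nonneg P _ _
  rw [logLik, likelihood, ← sum_log_ofReal _ _ fun i _ => prod_nonneg (h0 i)]
  exact sum_congr rfl fun i _ => sum_log_ofReal _ _ (h0 i)

/-- The accumulated squared total variation distance along the executed policies. -/
def sqDist (P Q : Dynamics O A H ν) (e : ℕ → List (Policy O A H)) (k : ℕ) : ℝ :=
  ∑ t ∈ range k, ((e t).map fun π => tvDist P Q π ^ 2).sum

theorem logLik_eq_coe {e : ℕ → List (Policy O A H)} {x : ℕ → ℕ → Traj O A H} {k : ℕ}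
    {Q : Dynamics O A H ν} (h : 0 < likelihood e x k Q) :
    logLik e x k Q = (Real.log (likelihood e x k Q) : EReal) := by
  rw [logLik_eq_log_likelihood, ENNReal.log_ofReal_of_pos h]

theorem logLik_le_of_likelihood_le {e : ℕ → List (Policy O A H)} {x : ℕ → ℕ → Traj O A H} {k : ℕ}
    {P Q : Dynamics O A H ν} {b : ℝ} (hQ : 0 < likelihood e x k Q)
    (h : likelihood e x k P ≤ likelihood e x k Q * Real.exp b) :
    logLik e x k P ≤ ((Real.log (likelihood e x k Q) + b : ℝ) : EReal) := by
  have hpos : 0 < likelihood e x k Q * Real.exp b := mul_pos hQ (Real.exp_pos b)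
  calc logLik e x k P ≤
        ENNReal.log (ENNReal.ofReal (likelihood e x k Q * Real.exp b)) := by
        rw [logLik_eq_log_likelihood]
        exact ENNReal.log_monotone (ENNReal.ofReal_le_ofReal h)
    _ = _ := by
        rw [ENNReal.log_ofReal_of_pos hpos, Real.log_mul hQ.ne' (Real.exp_pos b).ne',
          Real.log_exp]

variable [MeasurableSingletonClass A] [SigmaFinite ν] {Ω : Type*}

/-- On the event that the normalized likelihood-ratio process of a bracket stays below `c`, the
likelihood of every model in the bracket is controlled by the true likelihood, with a gain from
the squared distances to the true model. -/
theorem likelihood_le_of_ratioProcess_lt {P Q : Dynamics O A H ν}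
    {e : ℕ → Ω → List (Policy O A H)} {τ : ℕ → ℕ → Ω → Traj O A H} {k : ℕ} {ω : Ω}
    {l v : Traj O A H → ℝ} (hv : Measurable v) (hl : ∀ τ, l τ ≤ P.obsDensity τ)
    (hPv : ∀ τ, P.obsDensity τ ≤ v τ) {ε : ℝ} (hε : 0 ≤ ε) (hε1 : ε ≤ 1)
    (hd : policyDist ν l v < ENNReal.ofReal ε)
    (hpos : ∀ t < k, ∀ j (hj : j < (e t ω).length), 0 < trajDensity Q (e t ω)[j] (τ t j ω))
    (hnum : ∑ t ∈ range k, (e t ω).length * ε ≤ 1) {c : ℝ} (hc : 0 < c)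
    (hlt : ratioProcess Q v e τ k ω < ENNReal.ofReal c) :
    likelihood (fun t => e t ω) (fun t j => τ t j ω) k P ≤
      likelihood (fun t => e t ω) (fun t j => τ t j ω) k Q *
        Real.exp (2 * Real.log c + 2 - sqDist P Q (fun t => e t ω) k / 3) := by
  set r : (t : ℕ) → Fin (e t ω).length → ℝ := fun t j =>
    Real.sqrt (P.obsDensity (τ t j ω) / Q.obsDensity (τ t j ω)) with hr
  set s : (t : ℕ) → Fin (e t ω).length → ℝ := fun t j =>
    tvDist P Q ((e t ω).get j) ^ 2 with hs
  have hr0 : ∀ t j, 0 ≤ r t j := fun t j => Real.sqrt_nonneg _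
  have hfac : ∀ t (j : Fin (e t ω).length), ENNReal.ofReal (r t j * Real.exp (s t j / 6 - ε)) ≤
      sqrtRatio Q v (τ t j ω) * (∫⁻ x, sqrtRatio Q v x ∂(listLaw Q (e t ω) j))⁻¹ := by
    intro t j
    rw [ENNReal.ofReal_mul (hr0 t j)]
    refine mul_le_mul' (ENNReal.ofReal_le_ofReal (Real.sqrt_le_sqrt ?_)) ?_
    · exact div_le_div_of_nonneg_right (hPv _) (Q.obsDensity_nonneg _)
    · rw [listLaw_eq Q j.2, show s t j / 6 - ε = -(ε - s t j / 6) by ring, Real.exp_neg,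
        ENNReal.ofReal_inv_of_pos (Real.exp_pos _)]
      exact ENNReal.inv_le_inv.2 (affinity_le_exp P Q _ hv hl hPv hε hε1 hd)
  have hprod : (∏ t ∈ range k, ∏ j, r t j * Real.exp (s t j / 6 - ε)) ≤ c := by
    have h1 : ENNReal.ofReal (∏ t ∈ range k, ∏ j, r t j * Real.exp (s t j / 6 - ε)) ≤
        ENNReal.ofReal c := by
      refine le_trans ?_ hlt.le
      rw [ENNReal.ofReal_prod_of_nonneg fun t _ => prod_nonneg fun j _ =>
        mul_nonneg (hr0 t j) (Real.exp_pos _).le, ratioProcess]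
      refine prod_le_prod' fun t _ => ?_
      rw [ENNReal.ofReal_prod_of_nonneg fun j _ => mul_nonneg (hr0 t j) (Real.exp_pos _).le,
        prod_range]
      exact prod_le_prod' fun j _ => hfac t j
    exact (ENNReal.ofReal_le_ofReal_iff hc.le).1 h1
  set D := sqDist P Q (fun t => e t ω) k with hD
  have hDs : D = ∑ t ∈ range k, ∑ j, s t j := by
    rw [hD, sqDist]
    refine sum_congr rfl fun t _ => ?_
    rw [← Fin.sum_univ_fun_getElem]
    rfl
  set rr := ∏ t ∈ range k, ∏ j, r t j with hrr
  have hrr0 : 0 ≤ rr := prod_nonneg fun t _ => prod_nonneg fun j _ => hr0 t j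
  have hexp : rr * Real.exp (D / 6 - 1) ≤ c := by
    refine le_trans ?_ hprod
    simp only [prod_mul_distrib]
    refine mul_le_mul_of_nonneg_left ?_ hrr0
    simp only [← Real.exp_sum]
    refine Real.exp_le_exp.2 ?_
    simp only [sum_sub_distrib, ← sum_div, sum_const, card_univ, Fintype.card_fin, nsmul_eq_mul]
    rw [hDs]
    linarith
  have hrrc : rr ≤ c * Real.exp (1 - D / 6) := by
    rw [show 1 - D / 6 = -(D / 6 - 1) by ring, Real.exp_neg, ← div_eq_mul_inv,
      le_div_iff₀ (Real.exp_pos _)]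
    exact hexp
  have hlik : likelihood (fun t => e t ω) (fun t j => τ t j ω) k P =
      likelihood (fun t => e t ω) (fun t j => τ t j ω) k Q * rr ^ 2 := by
    simp only [likelihood, hrr, ← prod_pow, ← prod_mul_distrib]
    refine prod_congr rfl fun t ht => prod_congr rfl fun j _ => ?_
    have hq := hpos t (mem_range.1 ht) j j.2
    have hq' : Q.obsDensity (τ t j ω) ≠ 0 := by
      intro h
      rw [trajDensity, h, zero_mul] at hq
      exact lt_irrefl _ hq
    rw [hr, Real.sq_sqrt (div_nonneg (P.obsDensity_nonneg _) (Q.obsDensity_nonneg _)),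
      trajDensity, trajDensity]
    field_simp
  have hq0 : 0 ≤ likelihood (fun t => e t ω) (fun t j => τ t j ω) k Q :=
    prod_nonneg fun t _ => prod_nonneg fun j _ => trajDensity_nonneg Q _ _
  rw [hlik]
  refine mul_le_mul_of_nonneg_left ?_ hq0
  calc rr ^ 2 ≤ (c * Real.exp (1 - D / 6)) ^ 2 := pow_le_pow_left₀ hrr0 hrrc 2
    _ = Real.exp (2 * Real.log c + 2 - D / 3) := by
        conv_lhs => rw [← Real.exp_log hc]
        rw [← Real.exp_add, ← Real.exp_nat_mul]
        congr 1
        push_cast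
        ring

end Likelihood

section Confidence

variable {O A : Type*} [MeasurableSpace O] [MeasurableSpace A] [Fintype A] {H : ℕ}
  {ν : Measure O} {Θ : Type*} {P : Θ → Dynamics O A H ν} {θstar : Θ} {β : ℝ}
  {e : ℕ → List (Policy O A H)} {x : ℕ → ℕ → Traj O A H}

theorem mem_confSet_of_likelihood_le {K : ℕ}
    (hpos : ∀ k < K, 0 < likelihood e x k (P θstar))
    (hlik : ∀ k < K, 1 ≤ k → ∀ θ, likelihood e x k (P θ) ≤
      likelihood e x k (P θstar) * Real.exp β) :
    ∀ k < K, θstar ∈ confSet P β e x k := by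
  intro k
  induction k with
  | zero => intro _; exact Set.mem_univ _
  | succ k ih =>
    intro hk
    refine ⟨?_, ih (Nat.lt_of_succ_lt hk)⟩
    change (⨆ θ', logLik e x (k + 1) (P θ')) - (β : EReal) ≤ logLik e x (k + 1) (P θstar)
    rw [EReal.sub_le_iff_le_add (Or.inl (EReal.coe_ne_bot β)) (Or.inl (EReal.coe_ne_top β)),
      logLik_eq_coe (hpos _ hk), ← EReal.coe_add]
    exact iSup_le fun θ' =>
      logLik_le_of_likelihood_le (hpos _ hk) (hlik _ hk (Nat.succ_pos k) θ')

theorem le_of_mem_confSet {k : ℕ} (hk : 1 ≤ k) {θ : Θ} (hθ : θ ∈ confSet P β e x k) {b : ℝ}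
    (hpos : 0 < likelihood e x k (P θstar))
    (hlik : likelihood e x k (P θ) ≤ likelihood e x k (P θstar) * Real.exp b) : -β ≤ b := by
  obtain ⟨k, rfl⟩ := Nat.exists_eq_succ_of_ne_zero (Nat.one_le_iff_ne_zero.1 hk)
  have h1 : (⨆ θ', logLik e x (k + 1) (P θ')) - (β : EReal) ≤ logLik e x (k + 1) (P θ) := hθ.1
  rw [EReal.sub_le_iff_le_add (Or.inl (EReal.coe_ne_bot β)) (Or.inl (EReal.coe_ne_top β))] at h1
  have h2 := (le_iSup (fun θ' => logLik e x (k + 1) (P θ')) θstar).trans h1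
  rw [logLik_eq_coe hpos] at h2
  have h3 := h2.trans (add_le_add_left (logLik_le_of_likelihood_le hpos hlik) (β : EReal))
  rw [← EReal.coe_add, EReal.coe_le_coe_iff] at h3
  linarith

end Confidence

end

/-! ### Optimism and regret -/

section

open Finset

variable {O A : Type*} [MeasurableSpace O] [MeasurableSpace A] [Fintype A] {H : ℕ}
  {ν : Measure O} [MeasurableSingletonClass A] [SigmaFinite ν]

/-- Optimal brackets, and the fact that there is at least one. -/
theorem exists_brackets {Θ : Type*} [Nonempty Θ] {P : Θ → Dynamics O A H ν} {ε : ℝ} {M : ℕ}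
    (hM : bracketingNumber P ε = (M : ℕ∞)) :
    1 ≤ M ∧ ∃ l v : Fin M → Traj O A H → ℝ,
      (∀ i, Measurable (v i) ∧ policyDist ν (l i) (v i) < ENNReal.ofReal ε) ∧
      ∀ θ, ∃ i, ∀ τ, l i τ ≤ (P θ).obsDensity τ ∧ (P θ).obsDensity τ ≤ v i τ := by
  rw [bracketingNumber] at hM
  have hne : {N : ℕ∞ | ∃ (n : ℕ) (l u : Fin n → Traj O A H → ℝ), N = n ∧
    (∀ i, Measurable (l i) ∧ Measurable (u i) ∧
      policyDist ν (l i) (u i) < ENNReal.ofReal ε) ∧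
    ∀ θ, ∃ i, ∀ τ, l i τ ≤ (P θ).obsDensity τ ∧ (P θ).obsDensity τ ≤ u i τ}.Nonempty := by
    by_contra h
    rw [Set.not_nonempty_iff_eq_empty] at h
    rw [h, sInf_empty] at hM
    exact ENat.natCast_ne_top M hM.symm
  obtain ⟨n, l, v, hn, h1, h2⟩ := csInf_mem hne
  rw [hM] at hn
  obtain rfl : M = n := by exact_mod_cast hn
  refine ⟨?_, l, v, fun i => ⟨(h1 i).2.1, (h1 i).2.2⟩, h2⟩
  obtain ⟨i, -⟩ := h2 (Classical.arbitrary Θ)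
  exact Nat.one_le_iff_ne_zero.2 fun h => (h ▸ i).elim0

section Probability

variable {Ω : Type*} [mΩ : MeasurableSpace Ω] {Q : Dynamics O A H ν}
  {e : ℕ → Ω → List (Policy O A H)} {K : ℕ}
  {ℙ : Measure Ω} {ℱ : Filtration ℕ mΩ} {τ : ℕ → ℕ → Ω → Traj O A H}

/-- Markov's inequality and a union bound over the brackets and the episodes. -/
theorem IsAdaptiveSample.measure_ratioProcess_ge_le [IsProbabilityMeasure ℙ]
    (hs : IsAdaptiveSample Q e K ℙ ℱ τ) {M : ℕ} (hM : 1 ≤ M) (hK : 1 ≤ K)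
    {v : Fin M → Traj O A H → ℝ} (hv : ∀ i, Measurable (v i)) {δ : ℝ} (hδ : 0 < δ) :
    ℙ {ω | ∃ i, ∃ k < K, ENNReal.ofReal (M * K / δ) ≤ ratioProcess Q (v i) e τ k ω} ≤
      ENNReal.ofReal δ := by
  have hM' : (0 : ℝ) < M := by exact_mod_cast hM
  have hK' : (0 : ℝ) < K := by exact_mod_cast hK
  have hc : (0 : ℝ) < M * K / δ := by positivity
  have hsub : {ω | ∃ i, ∃ k < K, ENNReal.ofReal (M * K / δ) ≤ ratioProcess Q (v i) e τ k ω} ⊆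
      ⋃ i ∈ (univ : Finset (Fin M)), ⋃ k ∈ range K,
        {ω | ENNReal.ofReal (M * K / δ) ≤ ratioProcess Q (v i) e τ k ω} := by
    rintro ω ⟨i, k, hk, h⟩
    simp only [Set.mem_iUnion]
    exact ⟨i, mem_univ i, k, mem_range.2 hk, h⟩
  have hone : ∀ i, ∀ k ∈ range K,
      ℙ {ω | ENNReal.ofReal (M * K / δ) ≤ ratioProcess Q (v i) e τ k ω} ≤
        ENNReal.ofReal (δ / (M * K)) := by
    intro i k hk
    have hkK : k ≤ K := (mem_range.1 hk).le
    have hm := (hs.measurable_ratioProcess (hv i) hkK).mono (ℱ.le k) le_rfl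
    refine (meas_ge_le_lintegral_div hm.aemeasurable (by simpa using hc)
      ENNReal.ofReal_ne_top).trans ?_
    refine (ENNReal.div_le_div_right (hs.lintegral_ratioProcess_le_one (hv i) hkK) _).trans ?_
    rw [one_div, ← ENNReal.ofReal_inv_of_pos hc, inv_div]
  refine (measure_mono hsub).trans ((measure_biUnion_finset_le _ _).trans ?_)
  calc _ ≤ ∑ _i : Fin M, ∑ _k ∈ range K, ENNReal.ofReal (δ / (M * K)) :=
        sum_le_sum fun i _ => (measure_biUnion_finset_le _ _).trans (sum_le_sum (hone i))
    _ = ENNReal.ofReal δ := by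
        rw [← ENNReal.ofReal_sum_of_nonneg fun _ _ => by positivity,
          ← ENNReal.ofReal_sum_of_nonneg fun _ _ => by positivity]
        congr 1
        simp only [sum_const, card_univ, Fintype.card_fin, card_range, nsmul_eq_mul]
        field_simp

end Probability

/-- The confidence level `β = 5 log (K N M / δ)` absorbs the deviation terms as soon as `K ≥ 2`. -/
theorem two_log_add_two_le {K N M : ℕ} (hK : 2 ≤ K) (hN : 1 ≤ N) (hM : 1 ≤ M) {δ : ℝ}
    (hδ : 0 < δ) (hδ1 : δ ≤ 1) :
    2 * Real.log (M * K / δ) + 2 ≤ 5 * Real.log (K * N * M / δ) := by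
  have hK' : (2 : ℝ) ≤ K := by exact_mod_cast hK
  have hN' : (1 : ℝ) ≤ N := by exact_mod_cast hN
  have hM' : (1 : ℝ) ≤ M := by exact_mod_cast hM
  have hMK : (2 : ℝ) ≤ M * K := by nlinarith
  have h1 : Real.log (M * K / δ) ≤ Real.log (K * N * M / δ) := by
    refine Real.log_le_log (by positivity) ?_
    refine div_le_div_of_nonneg_right ?_ hδ.le
    calc (M : ℝ) * K ≤ M * K * N := le_mul_of_one_le_right (by positivity) hN'
      _ = K * N * M := by ring
  have h2 : Real.log 2 ≤ Real.log (M * K / δ) := by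
    refine Real.log_le_log (by norm_num) ?_
    rw [le_div_iff₀ hδ]
    nlinarith
  linarith [Real.log_two_gt_d9]

theorem rewardOf_outputLaw {R : Fin H → O → ℝ} (hR : ∀ h, Measurable (R h))
    (hR1 : ∀ h o, 0 ≤ R h o ∧ R h o ≤ 1) (P : Dynamics O A H ν) (π : ℕ → Policy O A H) (K : ℕ) :
    rewardOf R (outputLaw P π K) = (∑ t ∈ range K, value R P (π t)) / K := by
  rw [rewardOf, outputLaw, integral_smul_measure, integral_finsetSum_measure]
  · simp only [ENNReal.toReal_inv, ENNReal.toReal_natCast, smul_eq_mul]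
    rw [div_eq_inv_mul]
    rfl
  · intro t _
    exact integrable_totalReward hR hR1 _

/-- Optimism: if every estimated value dominates the optimal value, and the squared distances of
the selected models to the true model along the past policies are at most `6 β`, then the regret
is bounded. -/
theorem regret_le_of_optimism {Θ : Type*} {R : Fin H → O → ℝ} (hH : 1 ≤ H)
    (hR : ∀ h, Measurable (R h)) (hR1 : ∀ h o, 0 ≤ R h o ∧ R h o ≤ 1) {P : Θ → Dynamics O A H ν}
    {θstar : Θ} {greedy : Θ → Policy O A H} {expl : Policy O A H → List (Policy O A H)}
    {N d : ℕ} {κ B β : ℝ} (hN : ∀ π, (expl π).length ≤ N)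
    (hS : SAIL P θstar greedy expl d κ B) (hβ : 0 ≤ β) (θ : ℕ → Θ) {k : ℕ} (hk : 1 ≤ k)
    (hopt : ∀ t < k, ∀ π, value R (P θstar) π ≤ value R (P (θ t)) (greedy (θ t)))
    (hdist : ∀ t < k, sqDist (P (θ t)) (P θstar) (fun s => expl (greedy (θ s))) t ≤ 6 * β) :
    regret R (P θstar) (fun t => greedy (θ t)) k ≤
      sailBound 1200 4 H d B (sailDim 1200 4 H d κ N) k β N := by
  have : Nonempty (Policy O A H) := ⟨greedy θstar⟩
  refine le_trans ?_ (explicit_bound_le_sailBound hH hk κ hS.bound_nonneg hβ)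
  calc regret R (P θstar) (fun t => greedy (θ t)) k
      ≤ ∑ t ∈ range k, 2 * H * tvDist (P (θ t)) (P θstar) (greedy (θ t)) := by
        refine sum_le_sum fun t ht => ?_
        have h1 : optValue R (P θstar) ≤ value R (P (θ t)) (greedy (θ t)) :=
          ciSup_le (hopt t (mem_range.1 ht))
        have h2 := value_sub_value_le hR hR1 (P (θ t)) (P θstar) (greedy (θ t))
        linarith
    _ = 2 * H * ∑ t ∈ range k, tvDist (P (θ t)) (P θstar) (greedy (θ t)) := (mul_sum _ _ _).symm
    _ ≤ _ := mul_le_mul_of_nonneg_left (sum_tvDist_le_of_SAIL hN hS θ hk hdist) (by positivity)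

theorem IsOMLERun.isAdaptiveSample {Θ : Type*} {R : Fin H → O → ℝ} {P : Θ → Dynamics O A H ν}
    {θstar : Θ} {greedy : Θ → Policy O A H} {expl : Policy O A H → List (Policy O A H)} {K : ℕ}
    {β : ℝ} {Ω : Type*} [mΩ : MeasurableSpace Ω] {ℙ : Measure Ω} {ℱ : Filtration ℕ mΩ}
    {θ : ℕ → Ω → Θ} {τ : ℕ → ℕ → Ω → Traj O A H}
    (h : IsOMLERun R P θstar greedy expl K β ℙ ℱ θ τ) :
    IsAdaptiveSample (P θstar) (fun k ω => expl (greedy (θ k ω))) K ℙ ℱ τ :=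
  ⟨h.data_adapted, h.length_adapted, h.policy_adapted, h.sampling⟩

/-- On the event that all normalized likelihood-ratio processes stay small, the true model remains
in the confidence sets, and the models in them are close to the true model along the data. -/
theorem confSet_spec {Θ : Type*} {P : Θ → Dynamics O A H ν} {θstar : Θ} {Ω : Type*}
    {e : ℕ → Ω → List (Policy O A H)} {τ : ℕ → ℕ → Ω → Traj O A H} {ω : Ω} {K N M : ℕ}
    (hN : 1 ≤ N) (hlen : ∀ t, (e t ω).length ≤ N) (hM : 1 ≤ M) {δ : ℝ} (hδ : 0 < δ) (hδ1 : δ ≤ 1)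
    {l v : Fin M → Traj O A H → ℝ}
    (hlv : ∀ i, Measurable (v i) ∧
      policyDist ν (l i) (v i) < ENNReal.ofReal (1 / ((K : ℝ) * N)))
    (hcov : ∀ θ, ∃ i, ∀ τ, l i τ ≤ (P θ).obsDensity τ ∧ (P θ).obsDensity τ ≤ v i τ)
    (hpos : ∀ t < K, ∀ j (hj : j < (e t ω).length),
      0 < trajDensity (P θstar) (e t ω)[j] (τ t j ω))
    (hlt : ∀ i, ∀ k < K, ratioProcess (P θstar) (v i) e τ k ω < ENNReal.ofReal (M * K / δ))
    {β : ℝ} (hβ : β = 5 * Real.log (K * N * M / δ)) {k : ℕ} (hk : k < K) :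
    θstar ∈ confSet P β (fun t => e t ω) (fun t j => τ t j ω) k ∧
      ∀ θ ∈ confSet P β (fun t => e t ω) (fun t j => τ t j ω) k,
        sqDist (P θ) (P θstar) (fun t => e t ω) k ≤ 6 * β := by
  have hKpos : 1 ≤ K := Nat.one_le_of_lt hk
  have hK' : (1 : ℝ) ≤ K := by exact_mod_cast hKpos
  have hN' : (1 : ℝ) ≤ N := by exact_mod_cast hN
  have hM' : (1 : ℝ) ≤ M := by exact_mod_cast hM
  have hKN : (1 : ℝ) ≤ K * N := by nlinarith
  have hβ0 : 0 ≤ β := by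
    rw [hβ]
    refine mul_nonneg (by norm_num) (Real.log_nonneg ?_)
    rw [le_div_iff₀ hδ]
    nlinarith
  have hlik0 : ∀ k < K,
      0 < likelihood (fun t => e t ω) (fun t j => τ t j ω) k (P θstar) := fun k hk =>
    prod_pos fun t ht => prod_pos fun j _ =>
      hpos t ((mem_range.1 ht).trans hk) j j.2
  have hlik : ∀ k < K, ∀ θ, likelihood (fun t => e t ω) (fun t j => τ t j ω) k (P θ) ≤
      likelihood (fun t => e t ω) (fun t j => τ t j ω) k (P θstar) *
        Real.exp (2 * Real.log (M * K / δ) + 2 -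
          sqDist (P θ) (P θstar) (fun t => e t ω) k / 3) := by
    intro k hk θ
    obtain ⟨i, hi⟩ := hcov θ
    refine likelihood_le_of_ratioProcess_lt (ε := 1 / ((K : ℝ) * N)) (hlv i).1
      (fun τ => (hi τ).1) (fun τ => (hi τ).2) (by positivity) ?_ (hlv i).2
      (fun t ht => hpos t (ht.trans hk)) ?_ (by positivity) (hlt i k hk)
    · rw [div_le_one (by positivity)]
      exact hKN
    · calc ∑ t ∈ range k, ((e t ω).length : ℝ) * (1 / ((K : ℝ) * N))
          ≤ ∑ _t ∈ range k, (N : ℝ) * (1 / ((K : ℝ) * N)) := by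
            refine sum_le_sum fun t _ => mul_le_mul_of_nonneg_right ?_ (by positivity)
            exact_mod_cast hlen t
        _ = k / K := by
            rw [sum_const, card_range, nsmul_eq_mul]
            field_simp
        _ ≤ 1 := by
            rw [div_le_one (by positivity)]
            exact_mod_cast hk.le
  have hD0 : ∀ θ k, 0 ≤ sqDist (P θ) (P θstar) (fun t => e t ω) k := fun θ k =>
    sum_nonneg fun t _ => list_sum_map_nonneg _ fun π => sq_nonneg _
  -- Episode `0` uses no data, and a later episode exists only if `2 ≤ K`.
  have hβK : ∀ k < K, 1 ≤ k → 2 * Real.log (M * K / δ) + 2 ≤ β := by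
    intro k hk h1
    rw [hβ]
    exact two_log_add_two_le (by omega) hN hM hδ hδ1
  refine ⟨mem_confSet_of_likelihood_le hlik0 (fun k hk h1 θ => (hlik k hk θ).trans ?_) k hk,
    fun θ hθ => ?_⟩
  · refine mul_le_mul_of_nonneg_left (Real.exp_le_exp.2 ?_) (hlik0 k hk).le
    linarith [hβK k hk h1, hD0 θ k]
  · rcases Nat.eq_zero_or_pos k with rfl | h1
    · simpa [sqDist] using hβ0
    · have := le_of_mem_confSet h1 hθ (hlik0 k hk) (hlik k hk θ)
      linarith [hβK k hk h1]

end

end SeqDM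

end

theorem mainTheorem3 :
    ∃ (c C : ℝ) (p : ℕ), 0 < c ∧ 0 < C ∧
      ∀ (O : Type u) [MeasurableSpace O] (ν : Measure O) [SigmaFinite ν]
        (A : Type v) [Fintype A] [MeasurableSpace A] [MeasurableSingletonClass A]
        (H : ℕ) (_ : 1 ≤ H)
        (R : Fin H → O → ℝ) (_ : ∀ h, Measurable (R h)) (_ : ∀ h o, 0 ≤ R h o ∧ R h o ≤ 1)
        (Θ : Type w) (P : Θ → SeqDM.Dynamics O A H ν) (θstar : Θ)
        (greedy : Θ → SeqDM.Policy O A H) (_ : ∀ θ, SeqDM.IsOptimal R (P θ) (greedy θ))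
        (expl : SeqDM.Policy O A H → List (SeqDM.Policy O A H))
        (N : ℕ) (_ : 1 ≤ N) (_ : ∀ π, (expl π).length ≤ N)
        (d : ℕ) (κ B : ℝ) (_ : SeqDM.SAIL P θstar greedy expl d κ B),
        SeqDM.EluderCondition P θstar greedy expl N (SeqDM.sailDim C p H d κ N)
          (SeqDM.sailBound C p H d B) ∧
        ∀ (K : ℕ) (_ : 1 ≤ K) (δ : ℝ) (_ : 0 < δ) (_ : δ ≤ 1)
          (M : ℕ) (_ : SeqDM.bracketingNumber P (1 / ((K : ℝ) * N)) = (M : ℕ∞))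
          (β : ℝ) (_ : β = c * Real.log ((K : ℝ) * N * M / δ))
          (Ω : Type x) [mΩ : MeasurableSpace Ω] (ℙ : Measure Ω) [IsProbabilityMeasure ℙ]
          (ℱ : Filtration ℕ mΩ) (θ : ℕ → Ω → Θ) (τ : ℕ → ℕ → Ω → SeqDM.Traj O A H)
          (_ : SeqDM.IsOMLERun R P θstar greedy expl K β ℙ ℱ θ τ),
          ℙ {ω | ¬ ((∀ k, 1 ≤ k → k ≤ K →
                SeqDM.regret R (P θstar) (fun t => greedy (θ t ω)) k ≤
                  SeqDM.sailBound C p H d B (SeqDM.sailDim C p H d κ N) k β N) ∧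
              SeqDM.optValue R (P θstar) -
                  SeqDM.rewardOf R
                    (SeqDM.outputLaw (P θstar) (fun t => greedy (θ t ω)) K) ≤
                SeqDM.sailBound C p H d B (SeqDM.sailDim C p H d κ N) K β N / K)} ≤
            ENNReal.ofReal δ := by
  refine ⟨5, 1200, 4, by norm_num, by norm_num, ?_⟩
  intro O _ ν _ A _ _ _ H hH R hR hR1 Θ P θstar greedy _ expl N hN hlen d κ B hS
  refine ⟨SeqDM.eluderCondition_of_SAIL hH hlen hS, ?_⟩
  intro K hK δ hδ hδ1 M hM β hβ Ω _ ℙ _ ℱ θ τ hrun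
  have : Nonempty Θ := ⟨θstar⟩
  obtain ⟨hM1, l, v, hlv, hcov⟩ := SeqDM.exists_brackets hM
  have hs := hrun.isAdaptiveSample
  have hK' : (1 : ℝ) ≤ K := by exact_mod_cast hK
  have hN' : (1 : ℝ) ≤ N := by exact_mod_cast hN
  have hM' : (1 : ℝ) ≤ M := by exact_mod_cast hM1
  have hβ0 : 0 ≤ β := by
    rw [hβ]
    refine mul_nonneg (by norm_num) (Real.log_nonneg ?_)
    rw [le_div_iff₀ hδ, one_mul]
    have h1 : (1 : ℝ) ≤ K * N := by nlinarith
    nlinarith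
  have hbad := hs.measure_ratioProcess_ge_le hM1 hK (fun i => (hlv i).1) hδ
  have hnull := hs.ae_trajDensity_pos.and hrun.planning
  rw [ae_iff] at hnull
  refine (measure_mono ?_).trans ((measure_union_le _ _).trans
    ((add_le_add hbad hnull.le).trans (add_zero _).le))
  intro ω hω
  by_contra hgood
  rw [Set.mem_union, not_or] at hgood
  obtain ⟨h1, h2⟩ := hgood
  have hlt : ∀ i, ∀ k < K, SeqDM.ratioProcess (P θstar) (v i)
      (fun k ω => expl (greedy (θ k ω))) τ k ω < ENNReal.ofReal (M * K / δ) := by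
    intro i k hk
    by_contra h
    exact h1 ⟨i, k, hk, not_lt.1 h⟩
  obtain ⟨hpos, hplan⟩ := not_not.1 h2
  have hspec := fun k (hk : k < K) => SeqDM.confSet_spec (P := P) (θstar := θstar)
    (e := fun k ω => expl (greedy (θ k ω))) (τ := τ) (ω := ω) hN (fun t => hlen _) hM1 hδ hδ1
    hlv hcov hpos hlt hβ hk
  have hsel := fun k (hk : k < K) => hplan k hk ⟨θstar, (hspec k hk).1⟩
  have hreg : ∀ k, 1 ≤ k → k ≤ K → SeqDM.regret R (P θstar) (fun t => greedy (θ t ω)) k ≤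
      SeqDM.sailBound 1200 4 H d B (SeqDM.sailDim 1200 4 H d κ N) k β N := by
    intro k hk hkK
    exact SeqDM.regret_le_of_optimism hH hR hR1 hlen hS hβ0 (fun t => θ t ω) hk
      (fun t ht => (hsel t (ht.trans_le hkK)).2 θstar (hspec t (ht.trans_le hkK)).1)
      (fun t ht => (hspec t (ht.trans_le hkK)).2 _ (hsel t (ht.trans_le hkK)).1)
  refine hω ⟨hreg, ?_⟩
  rw [SeqDM.rewardOf_outputLaw hR hR1, le_div_iff₀ (by positivity)]
  refine le_trans (le_of_eq ?_) (hreg K hK le_rfl)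
  rw [SeqDM.regret, Finset.sum_sub_distrib, Finset.sum_const, Finset.card_range, nsmul_eq_mul]
  field_simp
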